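/- Let $k\ge 0$ and let $(M_i,g_i)$, $i=1,\dots,k$, be connected, complete smooth Riemannian manifolds (without boundary) of dimension $>1$. Assume that each $(M_i,g_i)$ is locally irreducible, i.e. for every $x\in M_i$ the restricted holonomy group of $(M_i,g_i)$ at $x$ (the group of parallel transports, for the Levi-Civita connection, along null-homotopic loops based at $x$) acts irreducibly on $T_xM_i$. Let $M_0=M_1\times\dots\times M_k$, with projections $p_i:M_0\to M_i$, be endowed with the product metric $g_0=\sum_i p_i^*g_i$. Let $\gamma$ be an isometry of $M_0$, i.e. a smooth diffeomorphism $\gamma:M_0\to M_0$ with $\gamma^*g_0=g_0$. Then there exist a permutation $\sigma$ of $\{1,\dots,k\}$ and isometries (smooth diffeomorphisms with $\tilde\gamma_i^*g_i=g_{\sigma(i)}$) $\tilde\gamma_i:M_{\sigma(i)}\to M_i$, $i=1,\dots,k$, such that $$p_i\circ\gamma=\tilde\gamma_i\circ p_{\sigma(i)}\qquad\text{for every } i\in\{1,\dots,k\}.$$ -/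

import Mathlib

open Set Bundle
open scoped Manifold ContDiff

noncomputable section

namespace RiemProd

section Holonomy

variable {E : Type*} [NormedAddCommGroup E] [NormedSpace ℝ E] [FiniteDimensional ℝ E]
  {H : Type*} [TopologicalSpace H] {I : ModelWithCorners ℝ E H}
  {M : Type*} [TopologicalSpace M] [ChartedSpace H M] [IsManifold I ∞ M]

/-- `cov` is a Levi-Civita connection: it is torsion-free and it is compatible with the Riemannian
metric, that is `u⟨Y, Z⟩ = ⟨∇_u Y, Z⟩ + ⟨Y, ∇_u Z⟩` for all vector fields `Y`, `Z` that are
differentiable at `x` and all tangent vectors `u` at `x` (`cov Y x u` is `∇_u Y`). On a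
Riemannian manifold there is such a connection, and any two of them agree at a point `x` on every
vector field that is differentiable at `x`. -/
def IsLeviCivita [RiemannianBundle (fun x : M ↦ TangentSpace I x)]
    (cov : CovariantDerivative I E (fun x : M ↦ TangentSpace I x)) : Prop :=
  cov.torsion = 0 ∧
  ∀ (x : M) (Y Z : ∀ y : M, TangentSpace I y),
    MDifferentiableAt I I.tangent (fun y ↦ (⟨y, Y y⟩ : TangentBundle I M)) x →
    MDifferentiableAt I I.tangent (fun y ↦ (⟨y, Z y⟩ : TangentBundle I M)) x →
    ∀ u : TangentSpace I x,
      mfderiv I 𝓘(ℝ, ℝ) (fun y ↦ inner ℝ (Y y) (Z y)) x u =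
        inner ℝ (cov Y x u) (Z x) + inner ℝ (Y x) (cov Z x u)

/-- The vector field `V` along the curve `c t = (V t).proj` (the time `t` ranging over `s`) is
parallel: it is differentiable, and its covariant derivative along `c` vanishes at each time.

At the time `t` we use the local frame `e_a` of the tangent bundle given by the trivialization at
`c t`. Writing `V = ∑ V_a e_a`, the covariant derivative is
`∑ (V_a' e_a + V_a ∇_{c'} e_a)`, so that it vanishes at `t` if and only if the coordinate vector
`(V_a)` has there the derivative `- ∇_{c'(t)} (∑ V_a(t) e_a)`; the vector field
`∑ V_a(t) e_a`, with constant coordinates, is `FiberBundle.extend E (V t).2`. -/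
def IsParallelAlong (cov : CovariantDerivative I E (fun x : M ↦ TangentSpace I x))
    (V : ℝ → TangentBundle I M) (s : Set ℝ) : Prop :=
  ∀ t ∈ s, HasDerivWithinAt
    (fun τ ↦ (trivializationAt E (TangentSpace I) (V t).proj (V τ)).2)
    (-(cov (FiberBundle.extend E (V t).2) (V t).proj
      (mfderivWithin 𝓘(ℝ, ℝ) I (fun τ ↦ (V τ).proj) s t (1 : ℝ))))
    s t

/-- `P` is the parallel transport along the `C¹` loop `c` based at `x`. -/
def IsParallelTransport (cov : CovariantDerivative I E (fun x : M ↦ TangentSpace I x)) {x : M}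
    (c : Path x x) (P : TangentSpace I x →ₗ[ℝ] TangentSpace I x) : Prop :=
  ∀ v : TangentSpace I x, ∃ V : ℝ → TangentBundle I M,
    (∀ t ∈ Icc (0 : ℝ) 1, (V t).proj = c.extend t) ∧
    IsParallelAlong cov V (Icc 0 1) ∧
    V 0 = ⟨x, v⟩ ∧ V 1 = ⟨x, P v⟩

/-- The restricted holonomy group at `x`: the parallel transports along the null-homotopic `C¹`
loops at `x`. (A piecewise `C¹` loop becomes `C¹` when it is reparametrized so as to stop at its
corners, which does not change the parallel transport, so using piecewise `C¹` loops gives the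
same group.) -/
def restrictedHolonomy (cov : CovariantDerivative I E (fun x : M ↦ TangentSpace I x)) (x : M) :
    Set (TangentSpace I x →ₗ[ℝ] TangentSpace I x) :=
  {P | ∃ c : Path x x, ContMDiffOn 𝓘(ℝ, ℝ) I 1 c.extend (Icc 0 1) ∧
    c.Homotopic (Path.refl x) ∧ IsParallelTransport cov c P}

variable (I M) in
/-- A Riemannian manifold is locally irreducible if the restricted holonomy group of its
Levi-Civita connection acts irreducibly on each tangent space. -/
def LocallyIrreducible [RiemannianBundle (fun x : M ↦ TangentSpace I x)] : Prop :=
  ∃ cov : CovariantDerivative I E (fun x : M ↦ TangentSpace I x), IsLeviCivita cov ∧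
    ∀ x : M, Nontrivial (TangentSpace I x) ∧
      ∀ W : Submodule ℝ (TangentSpace I x),
        (∀ P ∈ restrictedHolonomy cov x, ∀ w ∈ W, P w ∈ W) → W = ⊥ ∨ W = ⊤

end Holonomy

section Isometry

variable {E : Type*} [NormedAddCommGroup E] [NormedSpace ℝ E]
  {H : Type*} [TopologicalSpace H] {I : ModelWithCorners ℝ E H}
  {M : Type*} [TopologicalSpace M] [ChartedSpace H M]
  {E' : Type*} [NormedAddCommGroup E'] [NormedSpace ℝ E']
  {H' : Type*} [TopologicalSpace H'] {I' : ModelWithCorners ℝ E' H'}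
  {M' : Type*} [TopologicalSpace M'] [ChartedSpace H' M']

variable (I M) in
/-- The Riemannian metric of `M`, as a family of bilinear forms. -/
def metricForm [RiemannianBundle (fun x : M ↦ TangentSpace I x)] (x : M)
    (v w : TangentSpace I x) : ℝ :=
  inner ℝ v w

/-- The diffeomorphism `f : M → M'` is an isometry for the metrics `g` and `g'`, that is
`f^* g' = g`. -/
def IsIsometry (g : ∀ x : M, TangentSpace I x → TangentSpace I x → ℝ)
    (g' : ∀ y : M', TangentSpace I' y → TangentSpace I' y → ℝ) (f : M ≃ₘ^∞⟮I, I'⟯ M') : Prop :=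
  ∀ (x : M) (v w : TangentSpace I x),
    g' (f x) (mfderiv I I' f x v) (mfderiv I I' f x w) = g x v w

end Isometry

section Product

variable {ι : Type*} [Fintype ι]
  {E : ι → Type*} [∀ i, NormedAddCommGroup (E i)] [∀ i, NormedSpace ℝ (E i)]
  {H : ι → Type*} [∀ i, TopologicalSpace (H i)] (I : ∀ i, ModelWithCorners ℝ (E i) (H i))
  (M : ι → Type*) [∀ i, TopologicalSpace (M i)] [∀ i, ChartedSpace (H i) (M i)]
  [∀ i, RiemannianBundle (fun x : M i ↦ TangentSpace (I i) x)]

/-- The product metric `∑ p_i^* g_i` on `∏ M_i`, where `p_i` is the projection to `M_i`. -/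
def productMetric (x : ∀ i, M i) (v w : TangentSpace (ModelWithCorners.pi I) x) : ℝ :=
  ∑ i, metricForm (I i) (M i) (x i)
    (mfderiv (ModelWithCorners.pi I) (I i) (fun y : ∀ i, M i ↦ y i) x v)
    (mfderiv (ModelWithCorners.pi I) (I i) (fun y : ∀ i, M i ↦ y i) x w)

end Product

end RiemProd

end

/-! An isometry respects the Levi-Civita connection, and on a product a field is parallel exactly
when its components are. So $d\gamma$ sends parallel fields to fields with parallel components, and
each component has constant norm along the curve. In coordinates this rests on the transformation
law of the Christoffel symbols (`christoffel_transformation`). The norm (`componentNormSq`) is the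
convenient invariant: it is a scalar defined along the whole curve, although the parallel equation
is only read in charts.

Transporting along a loop that moves in the factor $M_i$ alone, it follows that the kernel of the
$l$-th component of $d\gamma$ is stable under the holonomy of $M_i$ acting on the $i$-th coordinate
(`piDeriv_update_holonomy`). Hence the vectors of $TM_i$ sent into $TM_j$ form an invariant
subspace, which is zero or everything. If it is zero, the $i$-th component of any vector sent into
$TM_j$ is fixed by the holonomy, hence zero because $\dim M_i>1$. So $d\gamma$ permutes the factors
at each point (`dichotomy_of_irreducible`, `exists_perm_of_dichotomy`).

The permutation is constant by connectedness (`exists_perm_forall`). Then $p_j\circ\gamma$ has zero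
derivative along all factors but one, so it depends on one coordinate only
(`apply_eq_of_piDeriv_eq_zero`), which gives the maps $\tilde\gamma_j$. -/

noncomputable section

namespace RiemProd

/-! ### Calculus on finite products of manifolds. -/

section PiManifold

variable {ι : Type*} [Fintype ι]
  {E : ι → Type*} [∀ i, NormedAddCommGroup (E i)] [∀ i, NormedSpace ℝ (E i)]
  {H : ι → Type*} [∀ i, TopologicalSpace (H i)] {I : ∀ i, ModelWithCorners ℝ (E i) (H i)}
  {M : ι → Type*} [∀ i, TopologicalSpace (M i)] [∀ i, ChartedSpace (H i) (M i)]
  {E' : Type*} [NormedAddCommGroup E'] [NormedSpace ℝ E']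
  {H' : Type*} [TopologicalSpace H'] {J : ModelWithCorners ℝ E' H'}
  {N : Type*} [TopologicalSpace N] [ChartedSpace H' N]

theorem hasMFDerivAt_pi_iff {f : N → ∀ i, M i} {x : N} {f' : E' →L[ℝ] ∀ i, E i} :
    HasMFDerivAt J (ModelWithCorners.pi I) f x f' ↔
      ∀ i, HasMFDerivAt J (I i) (fun y ↦ f y i) x ((ContinuousLinearMap.proj i).comp f') := by
  unfold HasMFDerivAt
  rw [continuousAt_pi, forall_and]
  exact and_congr_right fun _ ↦ hasFDerivWithinAt_pi'

theorem contMDiffAt_pi_iff {n : ℕ∞ω} {f : N → ∀ i, M i} {x : N} :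
    ContMDiffAt J (ModelWithCorners.pi I) n f x ↔
      ∀ i, ContMDiffAt J (I i) n (fun y ↦ f y i) x := by
  simp only [contMDiffAt_iff, forall_and]
  rw [continuousAt_pi]
  exact and_congr_right fun _ ↦ contDiffWithinAt_pi

theorem contMDiff_pi_iff {n : ℕ∞ω} {f : N → ∀ i, M i} :
    ContMDiff J (ModelWithCorners.pi I) n f ↔ ∀ i, ContMDiff J (I i) n (fun y ↦ f y i) :=
  ⟨fun h i x ↦ contMDiffAt_pi_iff.1 (h x) i, fun h x ↦ contMDiffAt_pi_iff.2 fun i ↦ h i x⟩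

theorem hasMFDerivAt_eval (i : ι) (x : ∀ i, M i) :
    HasMFDerivAt (ModelWithCorners.pi I) (I i) (fun y : ∀ i, M i ↦ y i) x
      (ContinuousLinearMap.proj i : (∀ i, E i) →L[ℝ] E i) :=
  hasMFDerivAt_pi_iff.1 (hasMFDerivAt_id x) i

theorem mfderiv_eval (i : ι) (x : ∀ i, M i) :
    mfderiv (ModelWithCorners.pi I) (I i) (fun y : ∀ i, M i ↦ y i) x =
      (ContinuousLinearMap.proj i : (∀ i, E i) →L[ℝ] E i) :=
  (hasMFDerivAt_eval i x).mfderiv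

theorem contMDiff_update [DecidableEq ι] (n : ℕ∞ω) (x : ∀ i, M i) (i : ι) :
    ContMDiff (I i) (ModelWithCorners.pi I) n (Function.update x i) := by
  refine contMDiff_pi_iff.2 fun j ↦ ?_
  by_cases h : j = i
  · subst h
    simpa using! contMDiff_id
  · simpa [Function.update_of_ne h] using! contMDiff_const

theorem hasMFDerivAt_update [DecidableEq ι] (x : ∀ i, M i) (i : ι) (y : M i) :
    HasMFDerivAt (I i) (ModelWithCorners.pi I) (Function.update x i) y
      (ContinuousLinearMap.single ℝ E i) := by
  refine hasMFDerivAt_pi_iff.2 fun j ↦ ?_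
  by_cases h : j = i
  · subst h
    have e1 : (fun y ↦ Function.update x j y j) = id := funext fun z ↦ by simp
    have e2 : (ContinuousLinearMap.proj j).comp (ContinuousLinearMap.single ℝ E j) =
        ContinuousLinearMap.id ℝ (E j) := by ext z; simp
    rw [e1]
    exact (congrArg (HasMFDerivAt (I j) (I j) id y) e2).mpr (hasMFDerivAt_id y)
  · have e1 : (fun y ↦ Function.update x i y j) = fun _ ↦ x j :=
      funext fun z ↦ by simp [Function.update_of_ne h]
    have e2 : (ContinuousLinearMap.proj j).comp (ContinuousLinearMap.single ℝ E i) =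
        (0 : E i →L[ℝ] E j) := by ext z; simp [Pi.single_eq_of_ne h]
    rw [e1]
    exact (congrArg (HasMFDerivAt (I i) (I j) (fun _ ↦ x j) y) e2).mpr
      (hasMFDerivAt_const (x j) y)

theorem productMetric_apply [∀ i, RiemannianBundle (fun x : M i ↦ TangentSpace (I i) x)]
    (x : ∀ i, M i) (v w : ∀ i, E i) :
    productMetric I M x v w = ∑ i, metricForm (I i) (M i) (x i) (v i) (w i) := by
  unfold productMetric
  simp only [mfderiv_eval]
  rfl

end PiManifold

/-! ### Isometries and Christoffel symbols in coordinates. -/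

section Coordinates

variable {ι κ : Type*} [Fintype ι] [Fintype κ]
  {E : ι → Type*} [∀ i, NormedAddCommGroup (E i)] [∀ i, NormedSpace ℝ (E i)]
  {F : κ → Type*} [∀ j, NormedAddCommGroup (F j)] [∀ j, NormedSpace ℝ (F j)]

set_option synthInstance.maxHeartbeats 400000 in
/-- The product rule for a bilinear form depending on a point, evaluated at two vectors. -/
theorem exists_hasFDerivAt_bilinear {X Y : Type*} [NormedAddCommGroup X] [NormedSpace ℝ X]
    [NormedAddCommGroup Y] [NormedSpace ℝ Y] {h : Y → Y →L[ℝ] Y →L[ℝ] ℝ}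
    {h' : Y →L[ℝ] Y →L[ℝ] Y →L[ℝ] ℝ} {φ A B : X → Y} {φ' A' B' : X →L[ℝ] Y} {z : X}
    (hh : HasFDerivAt h h' (φ z)) (hφ : HasFDerivAt φ φ' z) (hA : HasFDerivAt A A' z)
    (hB : HasFDerivAt B B' z) :
    ∃ L : X →L[ℝ] ℝ, HasFDerivAt (fun w ↦ h (φ w) (A w) (B w)) L z ∧
      ∀ u, L u = h' (φ' u) (A z) (B z) + h (φ z) (A' u) (B z) + h (φ z) (A z) (B' u) :=
  ⟨_, ((hh.comp z hφ).clm_apply hA).clm_apply hB, fun u ↦ by simp; ring⟩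

set_option synthInstance.maxHeartbeats 400000 in
theorem hasFDerivAt_unique_sum {X : Type*} [NormedAddCommGroup X] [NormedSpace ℝ X]
    {ι κ : Type*} [Fintype ι] [Fintype κ] {f : ι → X → ℝ} {g : κ → X → ℝ} {f' : ι → X →L[ℝ] ℝ}
    {g' : κ → X →L[ℝ] ℝ} {z : X} (hf : ∀ i, HasFDerivAt (f i) (f' i) z)
    (hg : ∀ j, HasFDerivAt (g j) (g' j) z)
    (h : ∀ᶠ w in nhds z, ∑ i, f i w = ∑ j, g j w) (u : X) :
    ∑ i, f' i u = ∑ j, g' j u := by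
  have h1 := HasFDerivAt.fun_sum (u := Finset.univ) fun i _ ↦ hf i
  have h2 := HasFDerivAt.fun_sum (u := Finset.univ) fun j _ ↦ hg j
  have h3 := DFunLike.congr_fun (h1.unique (h2.congr_of_eventuallyEq h)) u
  simpa only [sum_apply] using! h3

set_option synthInstance.maxHeartbeats 400000 in
/-- The transformation law of the Christoffel symbols under a local isometry between product
Riemannian metrics, both given in coordinates. -/
theorem christoffel_transformation
    {f : (∀ i, E i) → ∀ j, F j} {D : (∀ i, E i) → (∀ i, E i) →L[ℝ] ∀ j, F j}
    {D2 : (∀ i, E i) →L[ℝ] (∀ i, E i) →L[ℝ] ∀ j, F j} {z : ∀ i, E i}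
    (hf : HasFDerivAt f (D z) z) (hD : HasFDerivAt D D2 z) (hD2 : ∀ u v, D2 u v = D2 v u)
    {g : ∀ i, E i → E i →L[ℝ] E i →L[ℝ] ℝ} {g' : ∀ i, E i →L[ℝ] E i →L[ℝ] E i →L[ℝ] ℝ}
    (hg : ∀ i, HasFDerivAt (g i) (g' i) (z i))
    {h : ∀ j, F j → F j →L[ℝ] F j →L[ℝ] ℝ} {h' : ∀ j, F j →L[ℝ] F j →L[ℝ] F j →L[ℝ] ℝ}
    (hh : ∀ j, HasFDerivAt (h j) (h' j) (f z j))
    (hiso : ∀ᶠ w in nhds z, ∀ a b : ∀ i, E i,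
      ∑ j, h j (f w j) (D w a j) (D w b j) = ∑ i, g i (w i) (a i) (b i))
    (Γ : ∀ i, E i → E i → E i) (Γ' : ∀ j, F j → F j → F j)
    (hΓ : ∀ i u a b, g' i u a b = g i (z i) (Γ i u a) b + g i (z i) a (Γ i u b))
    (hΓ' : ∀ j u a b,
      h' j u a b = h j (f z j) (Γ' j u a) b + h j (f z j) a (Γ' j u b))
    (sΓ : ∀ i u a, Γ i u a = Γ i a u) (sΓ' : ∀ j u a, Γ' j u a = Γ' j a u)
    (hsymm : ∀ j a b, h j (f z j) a b = h j (f z j) b a)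
    (hpos : ∀ j a, a ≠ 0 → 0 < h j (f z j) a a)
    (hsurj : Function.Surjective (D z)) (u a : ∀ i, E i) (j : κ) :
    D2 u a j + Γ' j (D z u j) (D z a j) = D z (fun i ↦ Γ i (u i) (a i)) j := by
  have iso0 := hiso.self_of_nhds
  -- The isometry identity, with `a` and `b` fixed, differentiated in the direction `u`.
  have key : ∀ u a b : ∀ i, E i,
      ∑ j, (h' j (D z u j) (D z a j) (D z b j) + h j (f z j) (D2 u a j) (D z b j)
        + h j (f z j) (D z a j) (D2 u b j)) = ∑ i, g' i (u i) (a i) (b i) := by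
    intro u a b
    have hDa : ∀ (a : ∀ i, E i) (j : κ), HasFDerivAt (fun w ↦ D w a j)
        ((ContinuousLinearMap.proj j).comp (D2.flip a)) z := fun a ↦ by
      refine hasFDerivAt_pi'.1 ?_
      convert! hD.clm_apply (hasFDerivAt_const a z) using 1
      ext w
      simp
    choose L hL hLu using fun j ↦ exists_hasFDerivAt_bilinear (hh j) (hasFDerivAt_pi'.1 hf j)
      (hDa a j) (hDa b j)
    choose K hK hKu using fun i ↦ exists_hasFDerivAt_bilinear (hg i)
      (hasFDerivAt_pi'.1 (hasFDerivAt_id (𝕜 := ℝ) z) i) (hasFDerivAt_const (a i) z)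
      (hasFDerivAt_const (b i) z)
    have := hasFDerivAt_unique_sum hL hK (hiso.mono fun w hw ↦ hw a b) u
    simp only [hLu, hKu] at this
    simpa using this
  -- `S` is the defect in the transformation law; `s` pairs it with the image of a third vector.
  let S : (∀ i, E i) → (∀ i, E i) → ∀ j, F j := fun u a j ↦
    D2 u a j + Γ' j (D z u j) (D z a j) - D z (fun i ↦ Γ i (u i) (a i)) j
  let s : (∀ i, E i) → (∀ i, E i) → (∀ i, E i) → ℝ := fun u a b ↦
    ∑ j, h j (f z j) (S u a j) (D z b j)
  have Ssymm : ∀ u a, S u a = S a u := fun u a ↦ by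
    ext j
    simp only [S]
    rw [hD2 u a, sΓ']
    simp only [sΓ _ (u _)]
  -- Metric compatibility on both sides turns `key` into this, once the `g`-terms containing `Γ` are
  -- moved to the target by the isometry identity.
  have santi : ∀ u a b, s u a b = - s u b a := fun u a b ↦ by
    have k := key u a b
    have e1 := iso0 (fun i ↦ Γ i (u i) (a i)) b
    have e2 := iso0 a (fun i ↦ Γ i (u i) (b i))
    simp only [hΓ, hΓ', Finset.sum_add_distrib] at k
    have e3 : s u b a = ∑ j, h j (f z j) (D z a j) (S u b j) :=
      Finset.sum_congr rfl fun j _ ↦ hsymm _ _ _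
    rw [e3]
    simp only [s, S, map_add, map_sub, add_apply, sub_apply, Finset.sum_add_distrib, Finset.sum_sub_distrib]
    linarith
  -- Symmetric in the first two arguments and antisymmetric in the last two, hence zero: the
  -- argument for uniqueness of the Levi-Civita connection.
  have szero : ∀ u a b, s u a b = 0 := fun u a b ↦ by
    have sw : ∀ u a b, s u a b = s a u b := fun u a b ↦ by simp only [s, Ssymm u a]
    linarith [santi u a b, sw u b a, santi b u a, sw b a u, santi a b u, sw a u b]
  -- With this `b`, `s u a b` is the sum of the squared norms of the components of the defect.
  obtain ⟨b, hb⟩ := hsurj (S u a)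
  have hz := szero u a b
  simp only [s, hb] at hz
  have nonneg : ∀ j a, 0 ≤ h j (f z j) a a := fun j a ↦ by
    by_cases ha : a = 0
    · simp [ha]
    · exact (hpos j a ha).le
  have hj := (Finset.sum_eq_zero_iff_of_nonneg fun j _ ↦ nonneg j (S u a j)).1 hz j
    (Finset.mem_univ j)
  by_contra hne
  exact (hpos j (S u a j) fun h0 ↦ hne (sub_eq_zero.1 h0)).ne' hj

end Coordinates

/-! ### Metric and Levi-Civita connection in a chart. -/

section Chart

variable {E : Type*} [NormedAddCommGroup E] [NormedSpace ℝ E]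
  {M : Type*} [TopologicalSpace M] [ChartedSpace E M]

/-- The derivative of the inverse of the preferred chart at `p`. -/
def chartFrame (p : M) (w : E) : E →L[ℝ] E :=
  mfderiv 𝓘(ℝ, E) 𝓘(ℝ, E) (extChartAt 𝓘(ℝ, E) p).symm w

theorem metricForm_comm [RiemannianBundle (fun x : M ↦ TangentSpace 𝓘(ℝ, E) x)] (p : M)
    (a b : TangentSpace 𝓘(ℝ, E) p) :
    metricForm 𝓘(ℝ, E) M p a b = metricForm 𝓘(ℝ, E) M p b a :=
  real_inner_comm _ _

theorem metricForm_self_pos [RiemannianBundle (fun x : M ↦ TangentSpace 𝓘(ℝ, E) x)] (p : M)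
    {a : TangentSpace 𝓘(ℝ, E) p} (ha : a ≠ 0) :
    0 < metricForm 𝓘(ℝ, E) M p a a :=
  real_inner_self_pos.2 ha

variable [IsManifold 𝓘(ℝ, E) ∞ M]

/-- Links the trivialization, in which `IsParallelAlong` and `FiberBundle.extend` are expressed,
with the chart, in which derivatives are computed. -/
theorem symm_trivializationAt_eq_chartFrame {p q : M} (hq : q ∈ (chartAt E p).source) (a : E) :
    (trivializationAt E (TangentSpace 𝓘(ℝ, E)) p).symm q a =
      chartFrame p (extChartAt 𝓘(ℝ, E) p q) a := by
  have h := TangentBundle.symmL_trivializationAt (I := 𝓘(ℝ, E)) hq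
  rw [modelWithCornersSelf_coe, range_id, mfderivWithin_univ] at h
  exact (Trivialization.symmL_apply _ hq a).symm.trans (DFunLike.congr_fun h a)

theorem hasMFDerivAt_extChartAt_symm {p : M} {w : E} (hw : w ∈ (extChartAt 𝓘(ℝ, E) p).target) :
    HasMFDerivAt 𝓘(ℝ, E) 𝓘(ℝ, E) (extChartAt 𝓘(ℝ, E) p).symm w (chartFrame p w : E →L[ℝ] E) := by
  have h : MDifferentiableAt 𝓘(ℝ, E) 𝓘(ℝ, E) (extChartAt 𝓘(ℝ, E) p).symm w :=
    ((contMDiffOn_extChartAt_symm (n := ∞) (I := 𝓘(ℝ, E)) p).contMDiffAt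
      ((isOpen_extChartAt_target p).mem_nhds hw)).mdifferentiableAt (by simp)
  exact h.hasMFDerivAt

theorem chartFrame_self (p : M) (a : E) :
    chartFrame p (extChartAt 𝓘(ℝ, E) p p) a = a := by
  have h := mfderivWithin_range_extChartAt_symm (I := 𝓘(ℝ, E)) (x := p)
  rw [modelWithCornersSelf_coe, range_id, mfderivWithin_univ] at h
  exact DFunLike.congr_fun h a

theorem trivializationAt_self (p : M) (a : TangentSpace 𝓘(ℝ, E) p) :
    (trivializationAt E (TangentSpace 𝓘(ℝ, E)) p ⟨p, a⟩).2 = a := by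
  rw [TangentBundle.trivializationAt_apply]
  exact (tangentBundleCore 𝓘(ℝ, E) M).coordChange_self (achart E p) p (mem_chart_source E p) a

theorem extend_eq_chartFrame {p q : M} (hq : q ∈ (chartAt E p).source)
    (a : TangentSpace 𝓘(ℝ, E) p) :
    FiberBundle.extend E a q = chartFrame p (extChartAt 𝓘(ℝ, E) p q) (show E from a) :=
  (congrArg ((trivializationAt E (TangentSpace 𝓘(ℝ, E)) p).symm q)
    (trivializationAt_self p a)).trans (symm_trivializationAt_eq_chartFrame hq a)

theorem chartFrame_trivializationAt {p : M} {V : TangentBundle 𝓘(ℝ, E) M}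
    (hq : V.proj ∈ (chartAt E p).source) :
    chartFrame p (extChartAt 𝓘(ℝ, E) p V.proj)
      (trivializationAt E (TangentSpace 𝓘(ℝ, E)) p V).2 = V.2 :=
  (symm_trivializationAt_eq_chartFrame hq _).symm.trans
    ((trivializationAt E (TangentSpace 𝓘(ℝ, E)) p).symm_apply_apply_mk hq V.2)

theorem trivializationAt_chartFrame {p q : M} (hq : q ∈ (chartAt E p).source) (a : E) :
    (trivializationAt E (TangentSpace 𝓘(ℝ, E)) p
      (⟨q, chartFrame p (extChartAt 𝓘(ℝ, E) p q) a⟩ : TangentBundle 𝓘(ℝ, E) M)).2 = a := by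
  rw [← symm_trivializationAt_eq_chartFrame hq]
  exact congrArg Prod.snd
    ((trivializationAt E (TangentSpace 𝓘(ℝ, E)) p).apply_mk_symm hq a)

variable [RiemannianBundle (fun x : M ↦ TangentSpace 𝓘(ℝ, E) x)]

/-- The Riemannian metric in the preferred chart at `p`. -/
def chartMetric (p : M) (w : E) : E →L[ℝ] E →L[ℝ] ℝ :=
  ContinuousLinearMap.bilinearComp (E := E) (F := E)
    (RiemannianBundle.g (E := fun x : M ↦ TangentSpace 𝓘(ℝ, E) x) |>.inner
    ((extChartAt 𝓘(ℝ, E) p).symm w)) (chartFrame p w) (chartFrame p w)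

omit [IsManifold 𝓘(ℝ, E) ∞ M] in
theorem chartMetric_apply (p : M) (w a b : E) :
    chartMetric p w a b = metricForm 𝓘(ℝ, E) M ((extChartAt 𝓘(ℝ, E) p).symm w)
      (chartFrame p w a) (chartFrame p w b) := rfl

theorem chartMetric_self (p : M) (a b : E) :
    chartMetric p (extChartAt 𝓘(ℝ, E) p p) a b = metricForm 𝓘(ℝ, E) M p a b := by
  rw [chartMetric_apply, chartFrame_self, chartFrame_self, extChartAt_to_inv]

variable [IsContMDiffRiemannianBundle 𝓘(ℝ, E) ∞ E (fun x : M ↦ TangentSpace 𝓘(ℝ, E) x)]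

set_option synthInstance.maxHeartbeats 400000 in
theorem contDiffOn_chartMetric [FiniteDimensional ℝ E] (p : M) :
    ContDiffOn ℝ ∞ (chartMetric p) (extChartAt 𝓘(ℝ, E) p).target := by
  rw [contDiffOn_clm_apply]
  intro a
  rw [contDiffOn_clm_apply]
  intro b
  rw [← contMDiffOn_iff_contDiffOn]
  have sec : ∀ a : E, ContMDiffOn 𝓘(ℝ, E) 𝓘(ℝ, E).tangent ∞
      (fun w ↦ (⟨(extChartAt 𝓘(ℝ, E) p).symm w, chartFrame p w a⟩ : TangentBundle 𝓘(ℝ, E) M))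
      (extChartAt 𝓘(ℝ, E) p).target := by
    intro a
    have hs : ∀ w ∈ (extChartAt 𝓘(ℝ, E) p).target,
        (extChartAt 𝓘(ℝ, E) p).symm w ∈ (chartAt E p).source := fun w hw ↦ by
      simpa using (extChartAt 𝓘(ℝ, E) p).map_target hw
    rw [(trivializationAt E (TangentSpace 𝓘(ℝ, E)) p).contMDiffOn_iff
      (fun w hw ↦ by simpa using! hs w hw)]
    refine ⟨contMDiffOn_extChartAt_symm p, ?_⟩
    refine (contMDiffOn_const (c := a)).congr fun w hw ↦ ?_
    have := trivializationAt_chartFrame (hs w hw) a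
    rwa [(extChartAt 𝓘(ℝ, E) p).right_inv hw] at this
  exact ContMDiffOn.inner_bundle (E := fun x : M ↦ TangentSpace 𝓘(ℝ, E) x)
    (b := fun w ↦ (extChartAt 𝓘(ℝ, E) p).symm w) (sec a) (sec b)

variable [FiniteDimensional ℝ E]

/-- The Christoffel symbol of `cov` at `p` in the preferred chart at `p`: the covariant derivative
in the direction `u` of the coordinate field equal to `a` at `p`. -/
def christoffel (cov : CovariantDerivative 𝓘(ℝ, E) E (fun x : M ↦ TangentSpace 𝓘(ℝ, E) x))
    (p : M) (u a : E) : E :=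
  cov (FiberBundle.extend E (x := p) (E := fun x : M ↦ TangentSpace 𝓘(ℝ, E) x) a) p u

variable {cov : CovariantDerivative 𝓘(ℝ, E) E (fun x : M ↦ TangentSpace 𝓘(ℝ, E) x)}

-- Pulled back to the chart at `p`, both fields are constant near the base point.
open VectorField in
omit [FiniteDimensional ℝ E] [RiemannianBundle (fun x : M ↦ TangentSpace 𝓘(ℝ, E) x)]
  [IsContMDiffRiemannianBundle 𝓘(ℝ, E) ∞ E (fun x : M ↦ TangentSpace 𝓘(ℝ, E) x)] in
theorem mlieBracket_extend (p : M) (a b : TangentSpace 𝓘(ℝ, E) p) :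
    mlieBracket 𝓘(ℝ, E) (FiberBundle.extend E a) (FiberBundle.extend E b) p = 0 := by
  let X : E → E → E := fun a ↦ mpullbackWithin 𝓘(ℝ, E) 𝓘(ℝ, E) (extChartAt 𝓘(ℝ, E) p).symm
    (FiberBundle.extend E (x := p) (E := fun x : M ↦ TangentSpace 𝓘(ℝ, E) x) a)
    (range 𝓘(ℝ, E))
  have key : ∀ a : E, X a =ᶠ[nhds (extChartAt 𝓘(ℝ, E) p p)] fun _ ↦ a := by
    intro a
    filter_upwards [extChartAt_target_mem_nhds (I := 𝓘(ℝ, E)) p] with w hw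
    have hs : (extChartAt 𝓘(ℝ, E) p).symm w ∈ (chartAt E p).source := by
      simpa using (extChartAt 𝓘(ℝ, E) p).map_target hw
    refine (isInvertible_mfderivWithin_extChartAt_symm hw).inverse_apply_eq.2 ?_
    refine (extend_eq_chartFrame hs a).trans ?_
    rw [(extChartAt 𝓘(ℝ, E) p).right_inv hw, modelWithCornersSelf_coe, range_id,
      mfderivWithin_univ]
    rfl
  have hd : ∀ a : E, fderivWithin ℝ (X a) univ (extChartAt 𝓘(ℝ, E) p p) = 0 := fun a ↦ by
    rw [fderivWithin_univ, (key a).fderiv_eq, fderiv_fun_const]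
    rfl
  have hz : ∀ a b : E, lieBracketWithin ℝ (X a) (X b) univ (extChartAt 𝓘(ℝ, E) p p) = 0 := fun a b ↦ by
    unfold lieBracketWithin
    rw [hd, hd]
    simp
  rw [← mlieBracketWithin_univ, mlieBracketWithin_apply, modelWithCornersSelf_coe, preimage_univ,
    univ_inter]
  have hz' := hz a b
  simp only [X, modelWithCornersSelf_coe] at hz'
  refine (congrArg _ ?_).trans (map_zero _)
  rw [range_id] at hz' ⊢
  exact hz'

omit [IsContMDiffRiemannianBundle 𝓘(ℝ, E) ∞ E (fun x : M ↦ TangentSpace 𝓘(ℝ, E) x)] in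
theorem IsLeviCivita.covariantDerivative_extend_comm (h : IsLeviCivita cov) (p : M)
    (u a : TangentSpace 𝓘(ℝ, E) p) :
    cov (FiberBundle.extend E a) p u = cov (FiberBundle.extend E u) p a := by
  have h1 := cov.torsion_apply_eq_extend u a
  rw [mlieBracket_extend, FiberBundle.extend_apply_self, FiberBundle.extend_apply_self,
    sub_zero, h.1] at h1
  exact sub_eq_zero.1 h1.symm

omit [IsContMDiffRiemannianBundle 𝓘(ℝ, E) ∞ E (fun x : M ↦ TangentSpace 𝓘(ℝ, E) x)] in
theorem IsLeviCivita.christoffel_comm (h : IsLeviCivita cov) (p : M) (u a : E) :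
    christoffel cov p u a = christoffel cov p a u :=
  h.covariantDerivative_extend_comm p u a

/-- Metric compatibility for the coordinate fields extending `a` and `b`: in the chart, their inner
product is `chartMetric p w a b`. It is enough to have this at the centre of the chart, since the
charts are recentred at each time of the curve. -/
theorem IsLeviCivita.fderiv_chartMetric (h : IsLeviCivita cov) (p : M) (u a b : E) :
    fderiv ℝ (chartMetric p) (extChartAt 𝓘(ℝ, E) p p) u a b =
      chartMetric p (extChartAt 𝓘(ℝ, E) p p) (christoffel cov p u a) b +
      chartMetric p (extChartAt 𝓘(ℝ, E) p p) a (christoffel cov p u b) := by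
  set z := extChartAt 𝓘(ℝ, E) p p with hz
  have hG : DifferentiableAt ℝ (chartMetric p : E → E →L[ℝ] E →L[ℝ] ℝ) z :=
    ((contDiffOn_chartMetric p).contDiffAt (extChartAt_target_mem_nhds p)).differentiableAt
      (by simp)
  have hab : HasFDerivAt (fun w ↦ chartMetric p w a b)
      (((fderiv ℝ (chartMetric p) z).flip a).flip b) z := by
    convert! (hG.hasFDerivAt.clm_apply (hasFDerivAt_const a z)).clm_apply
      (hasFDerivAt_const b z) using 1
    ext u
    simp
  let A : E → ∀ y : M, TangentSpace 𝓘(ℝ, E) y := fun a ↦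
    FiberBundle.extend E (x := p) (E := fun x : M ↦ TangentSpace 𝓘(ℝ, E) x) a
  have hA : ∀ a, A a p = a := fun a ↦
    FiberBundle.extend_apply_self (F := E) (E := fun x : M ↦ TangentSpace 𝓘(ℝ, E) x) _
  have hm : HasMFDerivAt 𝓘(ℝ, E) 𝓘(ℝ, ℝ) (fun y ↦ inner ℝ (A a y) (A b y)) p
      (((fderiv ℝ (chartMetric p) z).flip a).flip b) := by
    have h1 : HasMFDerivAt 𝓘(ℝ, E) 𝓘(ℝ, E) (extChartAt 𝓘(ℝ, E) p) p
        (ContinuousLinearMap.id ℝ (TangentSpace 𝓘(ℝ, E) p)) := by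
      rw [← mfderiv_extChartAt_self]
      exact (mdifferentiableAt_extChartAt (mem_chart_source E p)).hasMFDerivAt
    refine (hab.hasMFDerivAt.comp p h1).congr_of_eventuallyEq ?_
    filter_upwards [(chartAt E p).open_source.mem_nhds (mem_chart_source E p)] with y hy
    have e := chartMetric_apply p (extChartAt 𝓘(ℝ, E) p y) a b
    rw [(extChartAt 𝓘(ℝ, E) p).left_inv (by simpa using hy)] at e
    exact (congrArg₂ (metricForm 𝓘(ℝ, E) M y) (extend_eq_chartFrame hy a)
      (extend_eq_chartFrame hy b)).trans e.symm
  have hdiff : ∀ a, MDifferentiableAt 𝓘(ℝ, E) 𝓘(ℝ, E).tangent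
      (fun y ↦ (⟨y, A a y⟩ : TangentBundle 𝓘(ℝ, E) M)) p := fun a ↦
    FiberBundle.mdifferentiableAt_extend ..
  have hc := h.2 p (A a) (A b) (hdiff a) (hdiff b) u
  rw [hm.mfderiv] at hc
  rw [hA, hA] at hc
  rw [chartMetric_self, chartMetric_self]
  exact hc

end Chart

/-! ### The isometry in product charts. -/

section Transport

set_option synthInstance.maxHeartbeats 400000 in
theorem hasDerivWithinAt_bilinear {Y : Type*} [NormedAddCommGroup Y] [NormedSpace ℝ Y]
    {h : Y → Y →L[ℝ] Y →L[ℝ] ℝ} {h' : Y →L[ℝ] Y →L[ℝ] Y →L[ℝ] ℝ} {y b : ℝ → Y} {y' b' : Y}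
    {s : Set ℝ} {t : ℝ} (hh : HasFDerivAt h h' (y t)) (hy : HasDerivWithinAt y y' s t)
    (hb : HasDerivWithinAt b b' s t) :
    HasDerivWithinAt (fun τ ↦ h (y τ) (b τ) (b τ))
      (h' y' (b t) (b t) + h (y t) b' (b t) + h (y t) (b t) b') s t := by
  obtain ⟨L, hL, hLu⟩ := exists_hasFDerivAt_bilinear (z := (y t, b t)) hh hasFDerivAt_fst
    hasFDerivAt_snd hasFDerivAt_snd
  have h1 : HasDerivWithinAt (fun τ ↦ h (y τ) (b τ) (b τ)) (L (y', b')) s t :=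
    HasFDerivAt.comp_hasDerivWithinAt (f := fun τ ↦ (y τ, b τ)) t hL (hy.prodMk hb)
  rwa [hLu] at h1

variable {ι : Type*} [Fintype ι]
  {E : ι → Type*} [∀ i, NormedAddCommGroup (E i)] [∀ i, NormedSpace ℝ (E i)]
  {M : ι → Type*} [∀ i, TopologicalSpace (M i)] [∀ i, ChartedSpace (E i) (M i)]

variable (E) in
/-- The model with corners of a product of boundaryless manifolds. -/
abbrev piModel : ModelWithCorners ℝ (∀ i, E i) (ModelPi E) :=
  ModelWithCorners.pi fun i ↦ 𝓘(ℝ, E i)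

/-- The inverse of the product of the preferred charts at `p`. -/
def piChartSymm (p : ∀ i, M i) (z : ∀ i, E i) : ∀ i, M i :=
  fun i ↦ (extChartAt 𝓘(ℝ, E i) (p i)).symm (z i)

/-- The derivative of `piChartSymm`. -/
def piFrame (p : ∀ i, M i) (z : ∀ i, E i) : (∀ i, E i) →L[ℝ] ∀ i, E i :=
  ContinuousLinearMap.pi fun i ↦ (chartFrame (p i) (z i)).comp (ContinuousLinearMap.proj i)

/-- The expression of `γ` in the preferred charts at `p` and `γ p`. -/
def chartExpr (γ : (∀ i, M i) → ∀ i, M i) (p : ∀ i, M i) (z : ∀ i, E i) : ∀ i, E i :=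
  fun l ↦ extChartAt 𝓘(ℝ, E l) (γ p l) (γ (piChartSymm p z) l)

/-- The coordinates of `x` in the product of the preferred charts at `p`. -/
def piChart (p x : ∀ i, M i) : ∀ i, E i := fun i ↦ extChartAt 𝓘(ℝ, E i) (p i) (x i)

omit [Fintype ι] in
theorem piChartSymm_piChart {p x : ∀ i, M i} (hx : ∀ i, x i ∈ (chartAt (E i) (p i)).source) :
    piChartSymm p (piChart (E := E) p x) = x :=
  funext fun i ↦ (extChartAt 𝓘(ℝ, E i) (p i)).left_inv (by simpa using hx i)

theorem eventually_mem_target (p : ∀ i, M i) :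
    ∀ᶠ z in nhds (piChart (E := E) p p), ∀ i, z i ∈ (extChartAt 𝓘(ℝ, E i) (p i)).target :=
  Filter.eventually_all.2 fun i ↦
    (continuous_apply i).continuousAt.eventually (extChartAt_target_mem_nhds (p i))

variable [∀ i, IsManifold 𝓘(ℝ, E i) ∞ (M i)]

theorem contMDiffAt_piChartSymm {p : ∀ i, M i} {z : ∀ i, E i}
    (hz : ∀ i, z i ∈ (extChartAt 𝓘(ℝ, E i) (p i)).target) :
    ContMDiffAt 𝓘(ℝ, ∀ i, E i) (piModel E) ∞ (piChartSymm p) z := by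
  refine contMDiffAt_pi_iff.2 fun i ↦ ?_
  have h := (contMDiffOn_extChartAt_symm (n := ∞) (I := 𝓘(ℝ, E i)) (p i)).contMDiffAt
    ((isOpen_extChartAt_target (p i)).mem_nhds (hz i))
  exact h.comp z (f := fun z : ∀ i, E i ↦ z i)
    (ContinuousLinearMap.proj (R := ℝ) (φ := E) i).contMDiff.contMDiffAt

theorem hasMFDerivAt_piChartSymm {p : ∀ i, M i} {z : ∀ i, E i}
    (hz : ∀ i, z i ∈ (extChartAt 𝓘(ℝ, E i) (p i)).target) :
    HasMFDerivAt 𝓘(ℝ, ∀ i, E i) (piModel E) (piChartSymm p) z (piFrame p z) := by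
  refine hasMFDerivAt_pi_iff.2 fun i ↦ ?_
  have h2 : HasMFDerivAt 𝓘(ℝ, ∀ i, E i) 𝓘(ℝ, E i) (fun z : ∀ i, E i ↦ z i) z
      (ContinuousLinearMap.proj (R := ℝ) (φ := E) i) :=
    (ContinuousLinearMap.proj (R := ℝ) (φ := E) i).hasFDerivAt.hasMFDerivAt
  have e : (ContinuousLinearMap.proj i).comp (piFrame p z) =
      (chartFrame (p i) (z i)).comp (ContinuousLinearMap.proj i) :=
    ContinuousLinearMap.proj_pi _ i
  exact (congrArg (HasMFDerivAt 𝓘(ℝ, ∀ i, E i) 𝓘(ℝ, E i) (fun z ↦ piChartSymm p z i) z) e).mpr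
    ((hasMFDerivAt_extChartAt_symm (hz i)).comp z h2)

variable {γ : (∀ i, M i) → ∀ i, M i}

theorem contDiffAt_chartExpr (hγ : ContMDiff (piModel E) (piModel E) ∞ γ) (p : ∀ i, M i) :
    ContDiffAt ℝ ∞ (chartExpr (E := E) γ p) (piChart p p) := by
  have hz := (eventually_mem_target (E := E) p).self_of_nhds
  have h1 := hγ.contMDiffAt.comp _ (contMDiffAt_piChartSymm hz)
  refine contDiffAt_pi.2 fun l ↦ contMDiffAt_iff_contDiffAt.1 ?_
  have e : piChartSymm p (piChart (E := E) p p) = p :=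
    piChartSymm_piChart fun i ↦ mem_chart_source _ _
  have h2 : ContMDiffAt 𝓘(ℝ, E l) 𝓘(ℝ, E l) ∞ (extChartAt 𝓘(ℝ, E l) (γ p l))
      (γ (piChartSymm p (piChart (E := E) p p)) l) := by
    rw [e]
    exact contMDiffAt_extChartAt
  exact h2.comp _ (contMDiffAt_pi_iff.1 h1 l)

/-- Needed on a neighbourhood and not only at `p`, because the isometry identity will be
differentiated in the chart. -/
theorem eventually_chartFrame_chartExpr (hγ : ContMDiff (piModel E) (piModel E) ∞ γ)
    (p : ∀ i, M i) :
    ∀ᶠ z in nhds (piChart (E := E) p p), ∀ l,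
      (extChartAt 𝓘(ℝ, E l) (γ p l)).symm (chartExpr γ p z l) = γ (piChartSymm p z) l ∧
      ∀ a : ∀ i, E i, chartFrame (γ p l) (chartExpr γ p z l) (fderiv ℝ (chartExpr γ p) z a l) =
        (show ∀ i, E i from
          mfderiv (piModel E) (piModel E) γ (piChartSymm p z) (piFrame p z a)) l := by
  have e : piChartSymm p (piChart (E := E) p p) = p :=
    piChartSymm_piChart fun i ↦ mem_chart_source _ _
  have hcont : ∀ l, ∀ᶠ z in nhds (piChart (E := E) p p),
      γ (piChartSymm p z) l ∈ (chartAt (E l) (γ p l)).source := fun l ↦ by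
    have hz := (eventually_mem_target (E := E) p).self_of_nhds
    have h1 := hγ.contMDiffAt.comp _ (contMDiffAt_piChartSymm hz)
    refine (contMDiffAt_pi_iff.1 h1 l).continuousAt.eventually
      ((chartAt (E l) (γ p l)).open_source.mem_nhds ?_)
    simp only [Function.comp_apply, e]
    exact mem_chart_source _ _
  have hdiff : ∀ᶠ z in nhds (piChart (E := E) p p), ContDiffAt ℝ 2 (chartExpr (E := E) γ p) z :=
    ((contDiffAt_chartExpr hγ p).of_le (by norm_cast)).eventually (by simp)
  have hinv : ∀ᶠ z in nhds (piChart (E := E) p p), ∀ l,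
      (extChartAt 𝓘(ℝ, E l) (γ p l)).symm (chartExpr γ p z l) = γ (piChartSymm p z) l :=
    Filter.eventually_all.2 fun l ↦ (hcont l).mono fun z hz ↦
      (extChartAt 𝓘(ℝ, E l) (γ p l)).left_inv (by simpa using hz)
  filter_upwards [eventually_mem_target (E := E) p, Filter.eventually_all.2 hcont, hdiff,
    hinv.eventually_nhds] with z hz hs hd hi l
  refine ⟨hi.self_of_nhds l, fun a ↦ ?_⟩
  have h1 : HasMFDerivAt 𝓘(ℝ, ∀ i, E i) 𝓘(ℝ, E l) (fun w ↦ γ (piChartSymm p w) l) z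
      ((ContinuousLinearMap.proj l : (∀ i, E i) →L[ℝ] E l).comp
        ((mfderiv (piModel E) (piModel E) γ (piChartSymm p z)).comp (piFrame p z))) :=
    hasMFDerivAt_pi_iff.1 (((hγ.mdifferentiable (by simp)) _).hasMFDerivAt.comp z
      (hasMFDerivAt_piChartSymm hz)) l
  have ht : chartExpr γ p z l ∈ (extChartAt 𝓘(ℝ, E l) (γ p l)).target :=
    (extChartAt 𝓘(ℝ, E l) (γ p l)).map_source (by simpa using hs l)
  have h2 := hasMFDerivAt_extChartAt_symm ht
  have h3 : HasMFDerivAt 𝓘(ℝ, ∀ i, E i) 𝓘(ℝ, E l) (fun w ↦ chartExpr γ p w l) z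
      ((ContinuousLinearMap.proj l : (∀ i, E i) →L[ℝ] E l).comp
        (fderiv ℝ (chartExpr γ p) z)) :=
    (hasFDerivAt_pi'.1 (hd.differentiableAt (by simp)).hasFDerivAt l).hasMFDerivAt
  -- Two computations of the derivative of the same map: through the target chart, and directly by
  -- the chain rule for `γ`.
  have h4 := (h2.comp z h3).congr_of_eventuallyEq (hi.mono fun w hw ↦ (hw l).symm)
  exact DFunLike.congr_fun (hasMFDerivAt_unique h4 h1) a

end Transport

/-! ### Isometries and parallel fields. -/

section Isometry

variable {ι : Type*} [Fintype ι]
  {E : ι → Type*} [∀ i, NormedAddCommGroup (E i)] [∀ i, NormedSpace ℝ (E i)]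
  {M : ι → Type*} [∀ i, TopologicalSpace (M i)] [∀ i, ChartedSpace (E i) (M i)]

/-- The differential of a self-map of a product manifold, as a linear map of the model space. -/
def piDeriv (γ : (∀ i, M i) → ∀ i, M i) (x : ∀ i, M i) : (∀ i, E i) →L[ℝ] ∀ i, E i :=
  mfderiv (piModel E) (piModel E) γ x

/-- The squared norm of the component along `M l` of the image under `γ` of a tangent vector. -/
def componentNormSq [∀ i, RiemannianBundle (fun x : M i ↦ TangentSpace 𝓘(ℝ, E i) x)]
    (γ : (∀ i, M i) → ∀ i, M i) (l : ι) (x : ∀ i, M i) (v : ∀ i, E i) : ℝ :=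
  metricForm 𝓘(ℝ, E l) (M l) (γ x l) (piDeriv γ x v l) (piDeriv γ x v l)

theorem componentNormSq_eq_zero_iff
    [∀ i, RiemannianBundle (fun x : M i ↦ TangentSpace 𝓘(ℝ, E i) x)]
    {γ : (∀ i, M i) → ∀ i, M i} {l : ι} {x : ∀ i, M i} {v : ∀ i, E i} :
    componentNormSq γ l x v = 0 ↔ piDeriv γ x v l = 0 := by
  refine ⟨fun h ↦ ?_, fun h ↦ ?_⟩
  · by_contra hne
    exact (metricForm_self_pos (γ x l) hne).ne' h
  · unfold componentNormSq
    rw [h]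
    exact inner_zero_left _

variable [∀ i, IsManifold 𝓘(ℝ, E i) ∞ (M i)]

theorem hasDerivWithinAt_extChartAt_comp {E : Type*} [NormedAddCommGroup E] [NormedSpace ℝ E]
    {M : Type*} [TopologicalSpace M] [ChartedSpace E M] {c : ℝ → M} {s : Set ℝ} {t : ℝ}
    (hc : MDifferentiableWithinAt 𝓘(ℝ, ℝ) 𝓘(ℝ, E) c s t) :
    HasDerivWithinAt (fun τ ↦ extChartAt 𝓘(ℝ, E) (c t) (c τ))
      (show E from mfderivWithin 𝓘(ℝ, ℝ) 𝓘(ℝ, E) c s t (1 : ℝ)) s t := by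
  let D : ℝ →L[ℝ] E := mfderivWithin 𝓘(ℝ, ℝ) 𝓘(ℝ, E) c s t
  have h : HasFDerivWithinAt (writtenInExtChartAt 𝓘(ℝ, ℝ) 𝓘(ℝ, E) t c) D
      ((extChartAt 𝓘(ℝ, ℝ) t).symm ⁻¹' s ∩ range 𝓘(ℝ, ℝ)) (extChartAt 𝓘(ℝ, ℝ) t t) :=
    hc.hasMFDerivWithinAt.2
  simp only [writtenInExtChartAt, extChartAt_model_space_eq_id, PartialEquiv.refl_coe,
    PartialEquiv.refl_symm, Function.comp_id, preimage_id, modelWithCornersSelf_coe, range_id,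
    inter_univ, id] at h
  exact h.hasDerivWithinAt

variable {γ : (∀ i, M i) → ∀ i, M i}

theorem fderiv_chartExpr_self (hγ : ContMDiff (piModel E) (piModel E) ∞ γ) (p : ∀ i, M i) :
    fderiv ℝ (chartExpr γ p) (piChart p p) = piDeriv (E := E) γ p := by
  have e : piChartSymm p (piChart (E := E) p p) = p :=
    piChartSymm_piChart fun i ↦ mem_chart_source _ _
  have e2 : ∀ a, piFrame p (piChart (E := E) p p) a = a := fun a ↦
    funext fun i ↦ chartFrame_self (p i) (a i)
  ext a l
  have h := ((eventually_chartFrame_chartExpr hγ p).self_of_nhds l).2 a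
  simp only [e2] at h
  have e3 : chartExpr (E := E) γ p (piChart p p) l = extChartAt 𝓘(ℝ, E l) (γ p l) (γ p l) := by
    unfold chartExpr
    rw [e]
  rw [e3, chartFrame_self, e] at h
  exact h

variable [∀ i, RiemannianBundle (fun x : M i ↦ TangentSpace 𝓘(ℝ, E i) x)]

theorem eventually_sum_chartMetric (hγ : ContMDiff (piModel E) (piModel E) ∞ γ)
    (hiso : ∀ (x : ∀ i, M i) (v w : ∀ i, E i),
      ∑ i, metricForm 𝓘(ℝ, E i) (M i) (γ x i) (piDeriv γ x v i) (piDeriv γ x w i) =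
      ∑ i, metricForm 𝓘(ℝ, E i) (M i) (x i) (v i) (w i)) (p : ∀ i, M i) :
    ∀ᶠ z in nhds (piChart (E := E) p p), ∀ a b : ∀ i, E i,
      ∑ l, chartMetric (γ p l) (chartExpr γ p z l) (fderiv ℝ (chartExpr γ p) z a l)
        (fderiv ℝ (chartExpr γ p) z b l) = ∑ i, chartMetric (p i) (z i) (a i) (b i) := by
  filter_upwards [eventually_chartFrame_chartExpr hγ p] with z hz a b
  refine Eq.trans (Finset.sum_congr rfl fun l _ ↦ ?_)
    (hiso (piChartSymm p z) (piFrame p z a) (piFrame p z b))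
  rw [chartMetric_apply, (hz l).2, (hz l).2, (hz l).1]
  rfl

theorem eventually_componentNormSq (hγ : ContMDiff (piModel E) (piModel E) ∞ γ)
    (p : ∀ i, M i) (l : ι) :
    ∀ᶠ z in nhds (piChart (E := E) p p), ∀ a : ∀ i, E i,
      componentNormSq γ l (piChartSymm p z) (piFrame p z a) =
        chartMetric (γ p l) (chartExpr γ p z l) (fderiv ℝ (chartExpr γ p) z a l)
        (fderiv ℝ (chartExpr γ p) z a l) := by
  filter_upwards [eventually_chartFrame_chartExpr hγ p] with z hz a
  rw [chartMetric_apply, (hz l).2, (hz l).1]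
  rfl

variable [∀ i, FiniteDimensional ℝ (E i)]
  [∀ i, IsContMDiffRiemannianBundle 𝓘(ℝ, E i) ∞ (E i) (fun x : M i ↦ TangentSpace 𝓘(ℝ, E i) x)]
  {cov : ∀ i, CovariantDerivative 𝓘(ℝ, E i) (E i) (fun x : M i ↦ TangentSpace 𝓘(ℝ, E i) x)}

set_option synthInstance.maxHeartbeats 400000 in
theorem fderiv_fderiv_chartExpr (hcov : ∀ i, IsLeviCivita (cov i))
    (hγ : ContMDiff (piModel E) (piModel E) ∞ γ)
    (hiso : ∀ (x : ∀ i, M i) (v w : ∀ i, E i),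
      ∑ i, metricForm 𝓘(ℝ, E i) (M i) (γ x i) (piDeriv γ x v i) (piDeriv γ x w i) =
      ∑ i, metricForm 𝓘(ℝ, E i) (M i) (x i) (v i) (w i))
    (hsurj : ∀ x, Function.Surjective (piDeriv (E := E) γ x))
    (p : ∀ i, M i) (u a : ∀ i, E i) (l : ι) :
    fderiv ℝ (fderiv ℝ (chartExpr γ p)) (piChart p p) u a l +
      christoffel (cov l) (γ p l) (piDeriv γ p u l) (piDeriv γ p a l) =
      piDeriv γ p (fun i ↦ christoffel (cov i) (p i) (u i) (a i)) l := by
  have e : piChartSymm p (piChart (E := E) p p) = p :=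
    piChartSymm_piChart fun i ↦ mem_chart_source _ _
  have e3 : ∀ l, chartExpr (E := E) γ p (piChart p p) l =
      extChartAt 𝓘(ℝ, E l) (γ p l) (γ p l) := fun l ↦ by
    unfold chartExpr
    rw [e]
  have hsm := contDiffAt_chartExpr hγ p
  have hmet : ∀ {i} (q : M i), HasFDerivAt (chartMetric (E := E i) q)
      (fderiv ℝ (chartMetric q) (extChartAt 𝓘(ℝ, E i) q q)) (extChartAt 𝓘(ℝ, E i) q q) :=
    fun q ↦ (((contDiffOn_chartMetric q).contDiffAt
      (extChartAt_target_mem_nhds q)).differentiableAt (by simp)).hasFDerivAt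
  have key := christoffel_transformation
    (f := chartExpr (E := E) γ p) (D := fderiv ℝ (chartExpr γ p))
    (D2 := fderiv ℝ (fderiv ℝ (chartExpr γ p)) (piChart p p)) (z := piChart p p)
    (hsm.differentiableAt (by simp)).hasFDerivAt
    ((hsm.fderiv_right (m := 1) (by norm_cast)).differentiableAt (by simp)).hasFDerivAt
    (hsm.isSymmSndFDerivAt (by rw [minSmoothness_of_isRCLikeNormedField]; norm_cast))
    (fun i ↦ hmet (p i))
    (h := fun j ↦ chartMetric (γ p j))
    (h' := fun j ↦ fderiv ℝ (chartMetric (γ p j)) (extChartAt 𝓘(ℝ, E j) (γ p j) (γ p j)))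
    (fun j ↦ by rw [e3]; exact hmet (γ p j))
    (eventually_sum_chartMetric hγ hiso p)
    (fun i ↦ christoffel (cov i) (p i)) (fun j ↦ christoffel (cov j) (γ p j))
    (fun i ↦ (hcov i).fderiv_chartMetric (p i))
    (fun j ↦ by rw [e3]; exact (hcov j).fderiv_chartMetric (γ p j))
    (fun i ↦ (hcov i).christoffel_comm (p i)) (fun j ↦ (hcov j).christoffel_comm (γ p j))
    (fun j a b ↦ by
      rw [e3, chartMetric_self, chartMetric_self]; exact metricForm_comm _ _ _)
    (fun j a ha ↦ by rw [e3, chartMetric_self]; exact metricForm_self_pos _ ha)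
    (by rw [fderiv_chartExpr_self hγ]; exact hsurj p) u a l
  rwa [fderiv_chartExpr_self hγ] at key

set_option synthInstance.maxHeartbeats 400000 in
/-- The differential of an isometry maps parallel fields to fields with parallel components; in
particular these have constant norm. -/
theorem hasDerivWithinAt_componentNormSq (hcov : ∀ i, IsLeviCivita (cov i))
    (hγ : ContMDiff (piModel E) (piModel E) ∞ γ)
    (hiso : ∀ (x : ∀ i, M i) (v w : ∀ i, E i),
      ∑ i, metricForm 𝓘(ℝ, E i) (M i) (γ x i) (piDeriv γ x v i) (piDeriv γ x w i) =
      ∑ i, metricForm 𝓘(ℝ, E i) (M i) (x i) (v i) (w i))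
    (hsurj : ∀ x, Function.Surjective (piDeriv (E := E) γ x))
    {V : ∀ i, ℝ → TangentBundle 𝓘(ℝ, E i) (M i)} {s : Set ℝ}
    (hV : ∀ i, IsParallelAlong (cov i) (V i) s)
    (hc : ∀ i, MDifferentiableOn 𝓘(ℝ, ℝ) 𝓘(ℝ, E i) (fun τ ↦ (V i τ).proj) s)
    (l : ι) {t : ℝ} (ht : t ∈ s) :
    HasDerivWithinAt (fun τ ↦ componentNormSq (E := E) γ l (fun i ↦ (V i τ).proj) (fun i ↦ (V i τ).2))
      0 s t := by
  let p : ∀ i, M i := fun i ↦ (V i t).proj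
  let z : ℝ → ∀ i, E i := fun τ ↦ piChart p fun i ↦ (V i τ).proj
  let a : ℝ → ∀ i, E i := fun τ i ↦ (trivializationAt (E i) (TangentSpace 𝓘(ℝ, E i)) (p i) (V i τ)).2
  let u : ∀ i, E i := fun i ↦ mfderivWithin 𝓘(ℝ, ℝ) 𝓘(ℝ, E i) (fun τ ↦ (V i τ).proj) s t (1 : ℝ)
  have hz : HasDerivWithinAt z u s t :=
    hasDerivWithinAt_pi.2 fun i ↦ hasDerivWithinAt_extChartAt_comp (hc i t ht)
  have hat : ∀ i, a t i = (V i t).2 := fun i ↦ trivializationAt_self (p i) (V i t).2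
  have ha : HasDerivWithinAt a (fun i ↦ -christoffel (cov i) (p i) (u i) (a t i)) s t :=
    hasDerivWithinAt_pi.2 fun i ↦ by
      rw [hat]
      exact hV i t ht
  have hsm := contDiffAt_chartExpr hγ p
  have hD : HasFDerivAt (fderiv ℝ (chartExpr γ p)) (fderiv ℝ (fderiv ℝ (chartExpr γ p)) (z t))
      (z t) := ((hsm.fderiv_right (m := 1) (by norm_cast)).differentiableAt (by simp)).hasFDerivAt
  have hF : HasFDerivAt (chartExpr γ p) (piDeriv γ p) (z t) := by
    rw [← fderiv_chartExpr_self hγ]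
    exact (hsm.differentiableAt (by simp)).hasFDerivAt
  let y : ℝ → ∀ i, E i := fun τ ↦ chartExpr γ p (z τ)
  let b : ℝ → ∀ i, E i := fun τ ↦ fderiv ℝ (chartExpr γ p) (z τ) (a τ)
  have hy : HasDerivWithinAt y (piDeriv γ p u) s t := hF.comp_hasDerivWithinAt t hz
  have hbt : b t = piDeriv γ p (a t) := by
    rw [← fderiv_chartExpr_self hγ]
  have hb0 : HasDerivWithinAt b (fderiv ℝ (fderiv ℝ (chartExpr γ p)) (z t) u (a t) +
      fderiv ℝ (chartExpr γ p) (z t) fun i ↦ -christoffel (cov i) (p i) (u i) (a t i)) s t :=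
    (hD.comp_hasDerivWithinAt t hz).clm_apply ha
  -- The transformation law absorbs the second derivative of `chartExpr`; what remains is the
  -- parallel equation for the `l`-th component of the image field.
  have hb : HasDerivWithinAt (fun τ ↦ b τ l)
      (-christoffel (cov l) (γ p l) (piDeriv γ p u l) (b t l)) s t := by
    refine (hasDerivWithinAt_pi.1 hb0 l).congr_deriv ?_
    have k := fderiv_fderiv_chartExpr hcov hγ hiso hsurj p u (a t) l
    have en : (fun i ↦ -christoffel (cov i) (p i) (u i) (a t i)) =
      -fun i ↦ christoffel (cov i) (p i) (u i) (a t i) := rfl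
    rw [fderiv_chartExpr_self hγ, hbt, en, map_neg, Pi.add_apply, Pi.neg_apply, ← k]
    abel
  have hyl : HasDerivWithinAt (fun τ ↦ y τ l) (piDeriv γ p u l) s t :=
    hasDerivWithinAt_pi.1 hy l
  have hyt : y t l = extChartAt 𝓘(ℝ, E l) (γ p l) (γ p l) := by
    have e : piChartSymm p (piChart (E := E) p p) = p :=
      piChartSymm_piChart fun i ↦ mem_chart_source _ _
    exact congrArg (fun x ↦ extChartAt 𝓘(ℝ, E l) (γ p l) (γ x l)) e
  have hmet : HasFDerivAt (chartMetric (E := E l) (γ p l))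
      (fderiv ℝ (chartMetric (γ p l)) (y t l)) (y t l) := by
    rw [hyt]
    exact (((contDiffOn_chartMetric (γ p l)).contDiffAt
      (extChartAt_target_mem_nhds (γ p l))).differentiableAt (by simp)).hasFDerivAt
  have hN := hasDerivWithinAt_bilinear hmet hyl hb
  -- Metric compatibility in the target chart: the derivative of the metric cancels the two
  -- Christoffel terms.
  have hzero : fderiv ℝ (chartMetric (γ p l)) (y t l) (piDeriv γ p u l) (b t l) (b t l) +
      chartMetric (γ p l) (y t l) (-christoffel (cov l) (γ p l) (piDeriv γ p u l) (b t l)) (b t l)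
      + chartMetric (γ p l) (y t l) (b t l)
        (-christoffel (cov l) (γ p l) (piDeriv γ p u l) (b t l)) = 0 := by
    rw [hyt, (hcov l).fderiv_chartMetric]
    simp
  rw [hzero] at hN
  -- The curve stays in the charts at `p` for times near `t`, so there the norm is given by its
  -- coordinate expression.
  have hev : ∀ᶠ τ in nhdsWithin t s,
      componentNormSq (E := E) γ l (fun i ↦ (V i τ).proj) (fun i ↦ (V i τ).2) =
        chartMetric (γ p l) (y τ l) (b τ l) (b τ l) := by
    have hsrc : ∀ᶠ τ in nhdsWithin t s, ∀ i, (V i τ).proj ∈ (chartAt (E i) (p i)).source :=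
      Filter.eventually_all.2 fun i ↦ (hc i t ht).continuousWithinAt.eventually
        ((chartAt (E i) (p i)).open_source.mem_nhds (mem_chart_source _ _))
    filter_upwards [hsrc, hz.continuousWithinAt.eventually
      (eventually_componentNormSq hγ p l)] with τ hτ h
    rw [← h (a τ)]
    have e1 : piChartSymm p (z τ) = fun i ↦ (V i τ).proj := piChartSymm_piChart hτ
    have e2 : piFrame p (z τ) (a τ) = fun i ↦ (V i τ).2 :=
      funext fun i ↦ chartFrame_trivializationAt (hτ i)
    rw [e1, e2]
  exact hN.congr_of_eventuallyEq hev (hev.self_of_nhdsWithin ht)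

end Isometry

/-! ### Linear algebra: irreducibility forces a permutation of the factors. -/

section LinearAlgebra

variable {ι : Type*} [DecidableEq ι] {E : ι → Type*} [∀ i, AddCommGroup (E i)]
  [∀ i, Module ℝ (E i)]

/-- If `G` acts irreducibly on a factor of dimension greater than one, then a subspace of the
product that is invariant under `G` either contains this factor or has zero component along it. -/
theorem dichotomy_of_irreducible {L : (∀ i, E i) →ₗ[ℝ] ∀ i, E i} {i : ι}
    (G : Set (E i →ₗ[ℝ] E i)) (hdim : 1 < Module.finrank ℝ (E i))
    (hirr : ∀ W : Submodule ℝ (E i), (∀ P ∈ G, ∀ w ∈ W, P w ∈ W) → W = ⊥ ∨ W = ⊤)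
    (hinv : ∀ P ∈ G, ∀ w l, L w l = 0 → L (Function.update w i (P (w i))) l = 0) (j : ι) :
    (∀ l, l ≠ j → ∀ v : E i, L (Pi.single i v) l = 0) ∨
      ∀ w, (∀ l, l ≠ j → L w l = 0) → w i = 0 := by
  -- The vectors of the factor `i` that `L` sends into the factor `j`.
  let W : Submodule ℝ (E i) :=
    { carrier := {v | ∀ l, l ≠ j → L (Pi.single i v) l = 0}
      add_mem' := fun {a b} ha hb l hl ↦ by
        rw [Pi.single_add, map_add, Pi.add_apply, ha l hl, hb l hl, add_zero]
      zero_mem' := fun l _ ↦ by simp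
      smul_mem' := fun r a ha l hl ↦ by
        rw [Pi.single_smul, map_smul, Pi.smul_apply, ha l hl, smul_zero] }
  have hW := hirr W fun P hP v hv l hl ↦ by
    have h := hinv P hP _ l (hv l hl)
    rwa [Pi.single_eq_same, Pi.single, Function.update_idem] at h
  rcases hW with hW | hW
  · right
    intro w hw
    -- Placed in the factor `i`, `P (w i) - w i` is the difference of two vectors that `L` sends
    -- into the factor `j`; so it lies in `W`, which is zero.
    have hfix : ∀ P ∈ G, P (w i) = w i := fun P hP ↦ by
      have hmem : P (w i) - w i ∈ W := fun l hl ↦ by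
        have e : (Pi.single i (P (w i) - w i) : ∀ i, E i) =
            Function.update w i (P (w i)) - w := by
          funext m
          by_cases hm : m = i
          · subst hm; simp
          · simp [hm]
        rw [e, map_sub, Pi.sub_apply, hw l hl, hinv P hP w l (hw l hl), sub_zero]
      rw [hW, Submodule.mem_bot] at hmem
      exact sub_eq_zero.1 hmem
    -- A fixed vector spans an invariant subspace, too small to be the whole factor.
    have hspan := hirr (Submodule.span ℝ {w i}) fun P hP v hv ↦ by
      obtain ⟨r, rfl⟩ := Submodule.mem_span_singleton.1 hv
      rw [map_smul, hfix P hP]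
      exact hv
    rcases hspan with h | h
    · exact Submodule.span_singleton_eq_bot.1 h
    · have h1 : Module.finrank ℝ (Submodule.span ℝ {w i}) ≤ 1 :=
        (finrank_span_le_card {w i}).trans (by simp)
      rw [h, finrank_top] at h1
      exact absurd hdim (not_lt.2 h1)
  · left
    intro l hl v
    have hv : v ∈ W := hW ▸ Submodule.mem_top
    exact hv l hl

variable [Finite ι] [∀ i, Nontrivial (E i)]

/-- A linear automorphism of a product such that the preimage of each factor either contains a
given factor or has zero component along it, permutes the factors. -/
theorem exists_perm_of_dichotomy {L : (∀ i, E i) →ₗ[ℝ] ∀ i, E i} (hL : Function.Bijective L)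
    (h : ∀ i j, (∀ l, l ≠ j → ∀ v : E i, L (Pi.single i v) l = 0) ∨
      ∀ w, (∀ l, l ≠ j → L w l = 0) → w i = 0) :
    ∃ σ : Equiv.Perm ι, ∀ l i, i ≠ σ l → ∀ v : E i, L (Pi.single i v) l = 0 := by
  -- The preimage of a nonzero vector of the factor `j` has some nonzero component `i`, which
  -- excludes the second alternative for that `i`.
  have hex : ∀ j, ∃ i, ∀ l, l ≠ j → ∀ v : E i, L (Pi.single i v) l = 0 := fun j ↦ by
    obtain ⟨e, he⟩ := exists_ne (0 : E j)
    obtain ⟨w, hw⟩ := hL.2 (Pi.single j e)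
    have hw0 : w ≠ 0 := fun h0 ↦ he (by simpa [h0] using congrFun hw.symm j)
    obtain ⟨i, hi⟩ := Function.ne_iff.1 hw0
    exact ⟨i, (h i j).resolve_right fun H ↦
      hi (H w fun l hl ↦ by rw [hw, Pi.single_eq_of_ne hl])⟩
  choose σ hσ using hex
  -- Otherwise one factor would be sent into two distinct factors, hence to zero.
  have hinj : Function.Injective σ := fun j j' hjj ↦ by
    by_contra hne
    obtain ⟨v, hv⟩ := exists_ne (0 : E (σ j))
    have hz : L (Pi.single (σ j) v) = 0 := by
      funext l
      by_cases hl : l = j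
      · have h' := hσ j' l fun h' ↦ hne (hl.symm.trans h')
        rw [← hjj] at h'
        exact h' v
      · exact hσ j l hl v
    have := hL.1 (hz.trans (map_zero L).symm)
    exact hv (by simpa using congrFun this (σ j))
  have hbij := Finite.injective_iff_bijective.1 hinj
  refine ⟨Equiv.ofBijective σ hbij, fun l i hi v ↦ ?_⟩
  obtain ⟨j, rfl⟩ := hbij.2 i
  exact hσ j l (fun hlj ↦ hi (by rw [hlj]; rfl)) v

end LinearAlgebra

/-! ### Holonomy invariance and openness. -/

section Holonomy

variable {ι : Type*} [Fintype ι] [DecidableEq ι]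
  {E : ι → Type*} [∀ i, NormedAddCommGroup (E i)] [∀ i, NormedSpace ℝ (E i)]
  [∀ i, FiniteDimensional ℝ (E i)]
  {M : ι → Type*} [∀ i, TopologicalSpace (M i)] [∀ i, ChartedSpace (E i) (M i)]
  [∀ i, IsManifold 𝓘(ℝ, E i) ∞ (M i)]

theorem isParallelAlong_const {E : Type*} [NormedAddCommGroup E] [NormedSpace ℝ E]
    [FiniteDimensional ℝ E] {M : Type*} [TopologicalSpace M] [ChartedSpace E M]
    [IsManifold 𝓘(ℝ, E) ∞ M]
    (cov : CovariantDerivative 𝓘(ℝ, E) E (fun x : M ↦ TangentSpace 𝓘(ℝ, E) x))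
    (v : TangentBundle 𝓘(ℝ, E) M) (s : Set ℝ) : IsParallelAlong cov (fun _ ↦ v) s := by
  intro t _
  refine (hasDerivWithinAt_const t s _).congr_deriv ?_
  rw [mfderivWithin_const]
  exact (neg_eq_zero.2 (map_zero _)).symm

variable [∀ i, RiemannianBundle (fun x : M i ↦ TangentSpace 𝓘(ℝ, E i) x)]
  [∀ i, IsContMDiffRiemannianBundle 𝓘(ℝ, E i) ∞ (E i) (fun x : M i ↦ TangentSpace 𝓘(ℝ, E i) x)]
  {cov : ∀ i, CovariantDerivative 𝓘(ℝ, E i) (E i) (fun x : M i ↦ TangentSpace 𝓘(ℝ, E i) x)}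
  {γ : (∀ i, M i) → ∀ i, M i}

/-- Move along the loop in the factor `i` and stay fixed in the others: `w` is transported to its
update by `P`, while the norm of the `l`-th component of its image stays constant, here zero. -/
theorem piDeriv_update_holonomy (hcov : ∀ i, IsLeviCivita (cov i))
    (hγ : ContMDiff (piModel E) (piModel E) ∞ γ)
    (hiso : ∀ (x : ∀ i, M i) (v w : ∀ i, E i),
      ∑ i, metricForm 𝓘(ℝ, E i) (M i) (γ x i) (piDeriv γ x v i) (piDeriv γ x w i) =
      ∑ i, metricForm 𝓘(ℝ, E i) (M i) (x i) (v i) (w i))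
    (hsurj : ∀ x, Function.Surjective (piDeriv (E := E) γ x))
    {x : ∀ i, M i} {i : ι} {P : E i →ₗ[ℝ] E i} (hP : P ∈ restrictedHolonomy (cov i) (x i))
    (w : ∀ i, E i) (l : ι) (hw : piDeriv γ x w l = 0) :
    piDeriv γ x (Function.update w i (P (w i))) l = 0 := by
  obtain ⟨c, hc, -, hpar⟩ := hP
  obtain ⟨U, hUc, hU, hU0, hU1⟩ := hpar (w i)
  let V : ∀ i, ℝ → TangentBundle 𝓘(ℝ, E i) (M i) :=
    Function.update (fun j _ ↦ (⟨x j, w j⟩ : TangentBundle 𝓘(ℝ, E j) (M j))) i U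
  have hVi : V i = U := Function.update_self ..
  have hVj : ∀ j, j ≠ i → V j = fun _ ↦ ⟨x j, w j⟩ := fun j hj ↦ Function.update_of_ne hj ..
  have hV : ∀ j, IsParallelAlong (cov j) (V j) (Icc 0 1) := fun j ↦ by
    by_cases hj : j = i
    · subst hj
      rwa [hVi]
    · rw [hVj j hj]
      exact isParallelAlong_const (cov j) _ _
  have hd : ∀ j, MDifferentiableOn 𝓘(ℝ, ℝ) 𝓘(ℝ, E j) (fun τ ↦ (V j τ).proj) (Icc 0 1) :=
    fun j ↦ by
      by_cases hj : j = i
      · subst hj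
        rw [hVi]
        exact (hc.mdifferentiableOn (by simp)).congr hUc
      · rw [hVj j hj]
        exact mdifferentiableOn_const
  have hder := fun t (ht : t ∈ Icc (0 : ℝ) 1) ↦
    hasDerivWithinAt_componentNormSq hcov hγ hiso hsurj hV hd l ht
  have hconst := constant_of_derivWithin_zero (fun t ht ↦ (hder t ht).differentiableWithinAt)
    (fun t ht ↦ (hder t (Ico_subset_Icc_self ht)).derivWithin
      (uniqueDiffOn_Icc one_pos t (Ico_subset_Icc_self ht))) 1 (right_mem_Icc.2 zero_le_one)
  have hp : ∀ (t : ℝ) (v : E i), U t = ⟨x i, v⟩ →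
      (fun j ↦ (V j t).proj) = x ∧
      (fun j ↦ ((V j t).2 : E j)) = Function.update w i v := fun t v ht ↦ by
    refine ⟨funext fun j ↦ ?_, funext fun j ↦ ?_⟩
    · by_cases hj : j = i
      · subst hj
        rw [hVi, ht]
      · rw [hVj j hj]
    · by_cases hj : j = i
      · subst hj
        rw [hVi, ht, Function.update_self]
      · rw [hVj j hj, Function.update_of_ne hj]
  obtain ⟨h0x, h0v⟩ := hp 0 (w i) hU0
  obtain ⟨h1x, h1v⟩ := hp 1 (P (w i)) hU1
  rw [← componentNormSq_eq_zero_iff] at hw ⊢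
  rw [Function.update_eq_self] at h0v
  rw [h0x, h1x] at hconst
  exact (congrArg (componentNormSq (E := E) γ l x) h1v).symm.trans
    (hconst.trans ((congrArg (componentNormSq (E := E) γ l x) h0v).trans hw))

-- Extend `v` with constant coordinates in the chart. The squared norm of the `j`-th component of
-- its image is continuous and positive at `p`, and the extension stays tangent to the factor `i`
-- because `piFrame` acts factor by factor.
set_option synthInstance.maxHeartbeats 400000 in
theorem isOpen_piDeriv_ne_zero (hγ : ContMDiff (piModel E) (piModel E) ∞ γ) (i j : ι) :
    IsOpen {x : ∀ i, M i | ∃ v : E i, piDeriv γ x (Pi.single i v) j ≠ 0} := by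
  rw [isOpen_iff_mem_nhds]
  rintro p ⟨v, hv⟩
  let Q : (∀ i, E i) → ℝ := fun z ↦ chartMetric (γ p j) (chartExpr γ p z j)
    (fderiv ℝ (chartExpr γ p) z (Pi.single i v) j) (fderiv ℝ (chartExpr γ p) z (Pi.single i v) j)
  have e3 : chartExpr (E := E) γ p (piChart p p) j =
      extChartAt 𝓘(ℝ, E j) (γ p j) (γ p j) := by
    unfold chartExpr
    rw [piChartSymm_piChart fun i ↦ mem_chart_source _ _]
  have hQ0 : 0 < Q (piChart p p) := by
    simp only [Q]
    rw [fderiv_chartExpr_self hγ, e3, chartMetric_self]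
    exact metricForm_self_pos _ hv
  have hsm := contDiffAt_chartExpr hγ p
  have hF : ContinuousAt (fun z ↦ chartExpr γ p z j) (piChart (E := E) p p) :=
    continuousAt_pi.1 hsm.continuousAt j
  have hD : ContinuousAt (fun z ↦ fderiv ℝ (chartExpr γ p) z (Pi.single i v) j)
      (piChart (E := E) p p) :=
    continuousAt_pi.1 ((hsm.fderiv_right (m := 0) (by simp)).continuousAt.clm_apply
      continuousAt_const) j
  have hG : ContinuousAt (chartMetric (E := E j) (γ p j)) (chartExpr γ p (piChart p p) j) := by
    rw [e3]
    exact ((contDiffOn_chartMetric (γ p j)).contDiffAt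
      (extChartAt_target_mem_nhds (γ p j))).continuousAt
  have hQ : ContinuousAt Q (piChart p p) :=
    ((ContinuousAt.comp (f := fun z ↦ chartExpr γ p z j) hG hF).clm_apply hD).clm_apply hD
  have hev := (hQ.eventually (lt_mem_nhds hQ0)).and (eventually_componentNormSq hγ p j)
  have hcont : ContinuousAt (piChart (E := E) p) p :=
    continuousAt_pi.2 fun i ↦ ContinuousAt.comp (f := fun x : ∀ i, M i ↦ x i)
      (continuousAt_extChartAt (p i)) (continuous_apply i).continuousAt
  have hsrc : ∀ᶠ x in nhds p, ∀ i, x i ∈ (chartAt (E i) (p i)).source :=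
    Filter.eventually_all.2 fun i ↦ (continuous_apply i).continuousAt.eventually
      ((chartAt (E i) (p i)).open_source.mem_nhds (mem_chart_source _ _))
  filter_upwards [hcont.eventually hev, hsrc] with x hx hs
  refine ⟨chartFrame (p i) (piChart p x i) v, fun h0 ↦ ?_⟩
  have h := hx.2 (Pi.single i v)
  rw [piChartSymm_piChart hs] at h
  have e : piFrame p (piChart p x) (Pi.single i v) =
      Pi.single i (chartFrame (p i) (piChart p x i) v) := by
    funext m
    by_cases hm : m = i
    · subst hm; simp [piFrame]
    · simp [piFrame, hm]
  rw [e, componentNormSq_eq_zero_iff.2 h0] at h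
  exact hx.1.ne h

end Holonomy

/-- Read in charts, `f` is constant on a small ball; so it is locally constant, and connectedness
concludes. -/
theorem eq_of_hasMFDerivAt_eq_zero {E : Type*} [NormedAddCommGroup E] [NormedSpace ℝ E]
    {M : Type*} [TopologicalSpace M] [ChartedSpace E M] [IsManifold 𝓘(ℝ, E) ∞ M]
    [PreconnectedSpace M] {F : Type*} [NormedAddCommGroup F] [NormedSpace ℝ F]
    {N : Type*} [TopologicalSpace N] [ChartedSpace F N] [IsManifold 𝓘(ℝ, F) ∞ N] {f : M → N}
    (hf : ∀ x, HasMFDerivAt 𝓘(ℝ, E) 𝓘(ℝ, F) f x (0 : E →L[ℝ] F)) (x y : M) : f x = f y := by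
  refine IsLocallyConstant.apply_eq_of_preconnectedSpace ?_ x y
  rw [IsLocallyConstant.iff_eventually_eq]
  intro p
  have hcont : Continuous f := continuous_iff_continuousAt.2 fun x ↦ (hf x).continuousAt
  let φ := extChartAt 𝓘(ℝ, E) p
  let ψ := extChartAt 𝓘(ℝ, F) (f p)
  have hnhds : ∀ᶠ z in nhds (φ p), z ∈ φ.target ∧ f (φ.symm z) ∈ (chartAt F (f p)).source := by
    refine Filter.Eventually.and (extChartAt_target_mem_nhds p) ?_
    have hc : ContinuousAt (fun z ↦ f (φ.symm z)) (φ p) :=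
      hcont.continuousAt.comp (continuousAt_extChartAt_symm p)
    refine hc.eventually ((chartAt F (f p)).open_source.mem_nhds ?_)
    simp only [φ, extChartAt_to_inv]
    exact mem_chart_source _ _
  obtain ⟨r, hr, hball⟩ := Metric.eventually_nhds_iff_ball.1 hnhds
  have hder : ∀ z ∈ Metric.ball (φ p) r, HasFDerivAt (fun z ↦ ψ (f (φ.symm z))) (0 : E →L[ℝ] F) z :=
    fun z hz ↦ by
      obtain ⟨h1, h2⟩ := hball z hz
      have h3 : MDifferentiableAt 𝓘(ℝ, F) 𝓘(ℝ, F) ψ (f (φ.symm z)) :=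
        mdifferentiableAt_extChartAt h2
      have h4 := ((hf (φ.symm z)).comp z (hasMFDerivAt_extChartAt_symm h1))
      have h5 := (h3.hasMFDerivAt.comp z h4).hasFDerivAt
      refine h5.congr_fderiv ?_
      ext v
      exact map_zero (mfderiv 𝓘(ℝ, F) 𝓘(ℝ, F) ψ (f (φ.symm z)))
  have hconst : ∀ z ∈ Metric.ball (φ p) r, ψ (f (φ.symm z)) = ψ (f p) := fun z hz ↦ by
    have h := Metric.isOpen_ball.is_const_of_fderiv_eq_zero (𝕜 := ℝ)
      (convex_ball (φ p) r).isPreconnected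
      (fun z hz ↦ (hder z hz).differentiableAt.differentiableWithinAt)
      (fun z hz ↦ (hder z hz).fderiv) hz (Metric.mem_ball_self hr)
    rwa [extChartAt_to_inv] at h
  filter_upwards [(continuousAt_extChartAt (I := 𝓘(ℝ, E)) p).eventually
    (Metric.ball_mem_nhds _ hr), (chartAt E p).open_source.mem_nhds (mem_chart_source E p)]
    with q hq hqs
  have h1 := hconst _ hq
  have h2 := (hball _ hq).2
  rw [(extChartAt 𝓘(ℝ, E) p).left_inv (by simpa using hqs)] at h1 h2
  exact ψ.injOn (by simpa [ψ] using h2) (by simp [ψ]) h1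

/-! ### From the differential to the map. -/

section Splitting

variable {ι : Type*} [Fintype ι] [DecidableEq ι]
  {E : ι → Type*} [∀ i, NormedAddCommGroup (E i)] [∀ i, NormedSpace ℝ (E i)]
  {M : ι → Type*} [∀ i, TopologicalSpace (M i)] [∀ i, ChartedSpace (E i) (M i)]
  {γ : (∀ i, M i) → ∀ i, M i}

theorem hasMFDerivAt_comp_update (hγ : ContMDiff (piModel E) (piModel E) ∞ γ) (x : ∀ i, M i)
    (i j : ι) (y : M i) :
    HasMFDerivAt 𝓘(ℝ, E i) 𝓘(ℝ, E j) (fun y ↦ γ (Function.update x i y) j) y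
      ((ContinuousLinearMap.proj j : (∀ i, E i) →L[ℝ] E j).comp
        ((piDeriv γ (Function.update x i y)).comp (ContinuousLinearMap.single ℝ E i))) := by
  have h : MDifferentiableAt (piModel E) (piModel E) γ (Function.update x i y) :=
    hγ.mdifferentiable (by simp) _
  exact hasMFDerivAt_pi_iff.1 (h.hasMFDerivAt.comp y (hasMFDerivAt_update x i y)) j

omit [DecidableEq ι] in
theorem bijective_piDeriv (γ : (∀ i, M i) ≃ₘ^∞⟮piModel E, piModel E⟯ (∀ i, M i))
    (x : ∀ i, M i) : Function.Bijective (piDeriv (E := E) γ x) :=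
  (γ.mfderivToContinuousLinearEquiv (by simp) x).bijective

variable [∀ i, IsManifold 𝓘(ℝ, E i) ∞ (M i)]

theorem apply_eq_of_piDeriv_eq_zero [∀ i, PreconnectedSpace (M i)]
    (hγ : ContMDiff (piModel E) (piModel E) ∞ γ) {j m : ι}
    (h : ∀ x, ∀ i, i ≠ m → ∀ v : E i, piDeriv γ x (Pi.single i v) j = 0)
    {x x' : ∀ i, M i} (hx : x m = x' m) : γ x j = γ x' j := by
  have hupd : ∀ (x : ∀ i, M i) (i : ι), i ≠ m → ∀ y : M i,
      γ (Function.update x i y) j = γ x j := fun x i hi y ↦ by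
    have hz : ∀ y : M i, HasMFDerivAt 𝓘(ℝ, E i) 𝓘(ℝ, E j) (fun y ↦ γ (Function.update x i y) j) y
        (0 : E i →L[ℝ] E j) := fun y ↦ by
      have e : (ContinuousLinearMap.proj j : (∀ i, E i) →L[ℝ] E j).comp
          ((piDeriv γ (Function.update x i y)).comp (ContinuousLinearMap.single ℝ E i)) =
          (0 : E i →L[ℝ] E j) := by
        ext v
        exact h _ i hi v
      exact e ▸ hasMFDerivAt_comp_update hγ x i j y
    have := eq_of_hasMFDerivAt_eq_zero hz y (x i)
    rwa [Function.update_eq_self] at this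
  -- `S` is the set of coordinates already switched from `x` to `x'`, one at a time.
  have hset : ∀ S : Finset ι, m ∉ S → γ (S.piecewise x' x) j = γ x j := fun S ↦ by
    induction S using Finset.induction_on with
    | empty => simp
    | insert i S _ ih =>
      intro hm
      rw [Finset.mem_insert, not_or] at hm
      rw [Finset.piecewise_insert, hupd _ i (Ne.symm hm.1), ih hm.2]
  have hfin : (Finset.univ.erase m).piecewise x' x = x' := by
    funext i
    by_cases hi : i = m
    · subst hi
      simpa using hx
    · exact Finset.piecewise_eq_of_mem _ _ _ (by simp [hi])
  rw [← hset (Finset.univ.erase m) (by simp), hfin]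

variable [∀ i, FiniteDimensional ℝ (E i)]
  [∀ i, RiemannianBundle (fun x : M i ↦ TangentSpace 𝓘(ℝ, E i) x)]
  [∀ i, IsContMDiffRiemannianBundle 𝓘(ℝ, E i) ∞ (E i) (fun x : M i ↦ TangentSpace 𝓘(ℝ, E i) x)]

/-- If the differential of `γ` permutes the factors at each point, then the permutation does not
depend on the point. -/
theorem exists_perm_forall [∀ i, ConnectedSpace (M i)]
    (hγ : ContMDiff (piModel E) (piModel E) ∞ γ) [∀ i, Nontrivial (E i)]
    (hsurj : ∀ x, Function.Surjective (piDeriv (E := E) γ x))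
    (h : ∀ x, ∃ σ : Equiv.Perm ι, ∀ l i, i ≠ σ l → ∀ v : E i, piDeriv γ x (Pi.single i v) l = 0) :
    ∃ σ : Equiv.Perm ι, ∀ x l i, i ≠ σ l → ∀ v : E i, piDeriv γ x (Pi.single i v) l = 0 := by
  choose σ hσ using h
  -- If this failed, the `l`-th component of the differential would vanish on every factor, against
  -- surjectivity.
  have hne : ∀ x l, ∃ v : E (σ x l), piDeriv γ x (Pi.single (σ x l) v) l ≠ 0 := fun x l ↦ by
    by_contra! hz
    obtain ⟨e, he⟩ := exists_ne (0 : E l)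
    obtain ⟨w, hw⟩ := hsurj x (Pi.single l e)
    apply he
    have h1 := congrFun hw l
    rw [Pi.single_eq_same, ← Finset.univ_sum_single w, map_sum, Finset.sum_apply] at h1
    rw [← h1]
    refine Finset.sum_eq_zero fun i _ ↦ ?_
    by_cases hi : i = σ x l
    · subst hi
      exact hz _
    · exact hσ x l i hi _
  let U : ι → ι → Set (∀ i, M i) := fun l i ↦ {x | ∃ v : E i, piDeriv γ x (Pi.single i v) l ≠ 0}
  have hU : ∀ x l i, x ∈ U l i ↔ i = σ x l := fun x l i ↦ by
    refine ⟨fun ⟨v, hv⟩ ↦ ?_, fun hi ↦ ?_⟩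
    · by_contra hi
      exact hv (hσ x l i hi v)
    · subst hi
      exact hne x l
  -- For fixed `l` the open sets `U l i` partition the product, so each is also closed.
  have hclopen : ∀ l i, IsClopen (U l i) := fun l i ↦ by
    refine ⟨⟨?_⟩, isOpen_piDeriv_ne_zero hγ i l⟩
    have e : (U l i)ᶜ = ⋃ i' ∈ {i' | i' ≠ i}, U l i' := by
      ext x
      simp only [mem_compl_iff, mem_iUnion, mem_ofPred_eq, hU, exists_prop, exists_eq_right]
      exact ne_comm
    rw [e]
    exact isOpen_biUnion fun i' _ ↦ isOpen_piDeriv_ne_zero hγ i' l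
  obtain ⟨x₀⟩ : Nonempty (∀ i, M i) := inferInstance
  refine ⟨σ x₀, fun x l i hi v ↦ hσ x l i (fun h' ↦ hi ?_) v⟩
  have hx : x ∈ U l (σ x₀ l) :=
    (hclopen l (σ x₀ l)).eq_univ ⟨x₀, (hU x₀ l _).2 rfl⟩ ▸ mem_univ x
  rw [h', ← (hU x l _).1 hx]

end Splitting

end RiemProd

end

/-! ### The splitting theorem. -/

theorem lemma3p5 {k : ℕ}
    {E : Fin k → Type*} [∀ i, NormedAddCommGroup (E i)] [∀ i, NormedSpace ℝ (E i)]
    [∀ i, FiniteDimensional ℝ (E i)]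
    {M : Fin k → Type*} [∀ i, EMetricSpace (M i)] [∀ i, ChartedSpace (E i) (M i)]
    [∀ i, IsManifold 𝓘(ℝ, E i) ∞ (M i)]
    [∀ i, RiemannianBundle (fun x : M i ↦ TangentSpace 𝓘(ℝ, E i) x)]
    [∀ i, IsContMDiffRiemannianBundle 𝓘(ℝ, E i) ∞ (E i)
      (fun x : M i ↦ TangentSpace 𝓘(ℝ, E i) x)]
    [∀ i, IsRiemannianManifold 𝓘(ℝ, E i) (M i)]
    [∀ i, ConnectedSpace (M i)] [∀ i, CompleteSpace (M i)]
    (hdim : ∀ i, 1 < Module.finrank ℝ (E i))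
    (hirr : ∀ i, RiemProd.LocallyIrreducible 𝓘(ℝ, E i) (M i))
    (γ : (∀ i, M i) ≃ₘ^∞⟮ModelWithCorners.pi (fun i ↦ 𝓘(ℝ, E i)),
      ModelWithCorners.pi (fun i ↦ 𝓘(ℝ, E i))⟯ (∀ i, M i))
    (hγ : RiemProd.IsIsometry (RiemProd.productMetric (fun i ↦ 𝓘(ℝ, E i)) M)
      (RiemProd.productMetric (fun i ↦ 𝓘(ℝ, E i)) M) γ) :
    ∃ (σ : Equiv.Perm (Fin k))
      (γ' : ∀ i, M (σ i) ≃ₘ^∞⟮𝓘(ℝ, E (σ i)), 𝓘(ℝ, E i)⟯ M i),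
      (∀ i, RiemProd.IsIsometry (RiemProd.metricForm 𝓘(ℝ, E (σ i)) (M (σ i)))
        (RiemProd.metricForm 𝓘(ℝ, E i) (M i)) (γ' i)) ∧
      ∀ (x : ∀ i, M i) (i : Fin k), γ x i = γ' i (x (σ i)) := by
  open RiemProd in
  have hnt : ∀ i, Nontrivial (E i) := fun i ↦
    Module.nontrivial_of_finrank_pos (R := ℝ) (zero_lt_one.trans (hdim i))
  choose cov hcov hirr using hirr
  have hsm : ContMDiff (piModel E) (piModel E) ∞ γ := γ.contMDiff
  have hiso : ∀ (x : ∀ i, M i) (v w : ∀ i, E i),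
      ∑ i, metricForm 𝓘(ℝ, E i) (M i) (γ x i) (piDeriv γ x v i) (piDeriv γ x w i) =
      ∑ i, metricForm 𝓘(ℝ, E i) (M i) (x i) (v i) (w i) := fun x v w ↦ by
    rw [← productMetric_apply, ← productMetric_apply]
    exact hγ x v w
  have hbij : ∀ x, Function.Bijective (piDeriv (E := E) γ x) := bijective_piDeriv γ
  have hsurj := fun x ↦ (hbij x).2
  obtain ⟨σ, hσ⟩ := exists_perm_forall hsm hsurj fun x ↦
    exists_perm_of_dichotomy (L := (piDeriv (E := E) γ x).toLinearMap) (hbij x) fun i ↦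
      dichotomy_of_irreducible (restrictedHolonomy (cov i) (x i)) (hdim i) (hirr i (x i)).2
        fun P hP w l ↦ piDeriv_update_holonomy hcov hsm hiso hsurj hP w l
  have hdep : ∀ (j : Fin k) {x x' : ∀ i, M i}, x (σ j) = x' (σ j) → γ x j = γ x' j :=
    fun j _ _ ↦ apply_eq_of_piDeriv_eq_zero hsm fun x i hi v ↦ hσ x j i hi v
  obtain ⟨x₀⟩ : Nonempty (∀ i, M i) := inferInstance
  have hval : ∀ (x : ∀ i, M i) (j : Fin k),
      γ x j = γ (Function.update x₀ (σ j) (x (σ j))) j := fun x j ↦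
    hdep j (Function.update_self ..).symm
  -- Freeze the other coordinates at `x₀`; for the inverse, freeze them at `γ x₀`.
  let γ' : ∀ j, M (σ j) ≃ₘ^∞⟮𝓘(ℝ, E (σ j)), 𝓘(ℝ, E j)⟯ M j := fun j ↦
    { toFun := fun y ↦ γ (Function.update x₀ (σ j) y) j
      invFun := fun z ↦ γ.symm (Function.update (γ x₀) j z) (σ j)
      left_inv := fun y ↦ by
        -- For `l ≠ j` the `l`-th coordinate of the image depends only on the coordinate `σ l ≠ σ
        -- j`, where the point still agrees with `x₀`.
        have e : Function.update (γ x₀) j (γ (Function.update x₀ (σ j) y) j) =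
            γ (Function.update x₀ (σ j) y) := by
          funext l
          by_cases hl : l = j
          · subst hl
            simp
          · rw [Function.update_of_ne hl]
            refine hdep l (Function.update_of_ne (fun h ↦ hl (σ.injective h)) _ _).symm
        simp only [e, γ.symm_apply_apply, Function.update_self]
      right_inv := fun z ↦ by
        simp only
        rw [← hval, γ.apply_symm_apply, Function.update_self]
      contMDiff_toFun :=
        contMDiff_pi_iff.1 (γ.contMDiff.comp (contMDiff_update ∞ x₀ (σ j))) j
      contMDiff_invFun :=
        contMDiff_pi_iff.1 (γ.symm.contMDiff.comp (contMDiff_update ∞ (γ x₀) j)) (σ j) }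
  refine ⟨σ, γ', fun j y v w ↦ ?_, fun x j ↦ hval x j⟩
  have hder := hasMFDerivAt_comp_update hsm x₀ (σ j) j y
  have hmf : mfderiv 𝓘(ℝ, E (σ j)) 𝓘(ℝ, E j) (γ' j) y = _ := hder.mfderiv
  have hzero : ∀ (i : Fin k) (p : M i) (a b : E i), a = 0 → metricForm 𝓘(ℝ, E i) (M i) p a b = 0 :=
    fun i p a b ha ↦ by
      subst ha
      exact inner_zero_left (𝕜 := ℝ) (E := TangentSpace 𝓘(ℝ, E i) p) b
  -- On vectors tangent to the factor `σ j`, the isometry identity keeps only the term `j` on the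
  -- left and the term `σ j` on the right.
  have hcomp : ∀ v w : E (σ j), metricForm 𝓘(ℝ, E j) (M j) (γ (Function.update x₀ (σ j) y) j)
      (piDeriv γ (Function.update x₀ (σ j) y) (Pi.single (σ j) v) j)
      (piDeriv γ (Function.update x₀ (σ j) y) (Pi.single (σ j) w) j) =
      metricForm 𝓘(ℝ, E (σ j)) (M (σ j)) y v w := fun v w ↦ by
    have h := hiso (Function.update x₀ (σ j) y) (Pi.single (σ j) v) (Pi.single (σ j) w)
    rwa [Finset.sum_eq_single j
        (fun l _ hl ↦ hzero _ _ _ _ (hσ _ l (σ j) (fun h ↦ hl (σ.injective h).symm) v)) (by simp),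
      Finset.sum_eq_single (σ j)
        (fun l _ hl ↦ hzero _ _ _ _ (Pi.single_eq_of_ne hl _)) (by simp),
      Pi.single_eq_same, Pi.single_eq_same, Function.update_self] at h
  rw [hmf]
  exact hcomp v w
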